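/- Let $N\ge 1$ be an integer and let $T>0$, $\lambda>0$. For $x,y\in\mathbb R^N$ and $t>0$ let $$g_\lambda(x,t,y)=\Big(\frac{\lambda}{2\pi\sinh(\lambda t)}\Big)^{N/2}\exp\Big[-\frac{\lambda\big(\cosh(\lambda t)(|x|^2+|y|^2)-2(x,y)_{\mathbb R^N}\big)}{2\sinh(\lambda t)}\Big]$$ be Mehler's kernel (the Green function of $\partial_t u=\frac12\Delta u-\frac{\lambda^2}{2}|x|^2u$), let $$\varphi_{0,\lambda}(x)=\psi_{T,\lambda}(x)=\Big(\frac{\lambda e^{\lambda T}}{\pi}\Big)^{N/4}e^{-\lambda|x|^2/2},$$ and let $\mu_\lambda(F)=\int_F\varphi_{0,\lambda}(x)\,\psi_{T,\lambda}(y)\,g_\lambda(x,T,y)\,dx\,dy$ for Borel $F\subset\mathbb R^N\times\mathbb R^N$. An $\mathbb R^N$-valued process $(Z_\tau)_{\tau\in[0,T]}$ on a probability space $(\Omega,\mathcal F,\mathbb P)$ is called the Bernstein process associated with these data if (i) $\mathbb E\big(f(Z_r)\,\big|\,\mathcal F_s^+\vee\mathcal F_t^-\big)=\mathbb E\big(f(Z_r)\,\big|\,Z_s,Z_t\big)$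 for all $0\le s<r<t\le T$ and all bounded Borel $f:\mathbb R^N\to\mathbb R$, where $\mathcal F_s^+=\sigma(Z_\tau:\tau\le s)$ and $\mathcal F_t^-=\sigma(Z_\tau:\tau\ge t)$; (ii) for all $0\le s<r<t\le T$ and all Borel $E\subset\mathbb R^N$, $$\mathbb P(Z_r\in E\mid Z_s,Z_t)=\int_E\frac{g_\lambda(Z_t,t-r,z)\,g_\lambda(z,r-s,Z_s)}{g_\lambda(Z_t,t-s,Z_s)}\,dz\quad\text{almost surely};$$ (iii) the joint law of $(Z_0,Z_T)$ is $\mu_\lambda$. Then such a process exists on some complete probability space, and every such process $Z$ has the following properties. It is a Gaussian process, and it is Markovian, i.e. $\mathbb E(f(Z_t)\mid\mathcal F_s^+)=\mathbb E(f(Z_t)\mid Z_s)$ for $0\le s\le t\le T$ and bounded Borel $f$. For every $t\in[0,T]$ and every Borel $E\subset\mathbb R^N$, $$\mathbb P(Z_t\in E)=(2\pi\sigma_\lambda)^{-N/2}\int_E\exp\Big[-\frac{|x|^2}{2\sigma_\lambda}\Big]dx,\qquad \sigma_\lambda=\frac1{2\lambda}.$$ Its components satisfy $$\mathbb E\big(Z_s^{i}Z_t^{j}\big)=\frac{e^{-\lambda|t-s|}}{2\lambda}\,\delta_{i,j}$$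 for all $s,t\in[0,T]$ and $i,j\in\{1,\dots,N\}$, the products being integrable. Finally, $Z$ has the same law (as a process on $[0,T]$) as the restriction to $[0,T]$ of a process $X=(X^1,\dots,X^N)$ indexed by $[0,\infty)$ whose components are independent processes and are all one-dimensional stationary Ornstein–Uhlenbeck processes, that is, stationary processes with almost surely continuous paths such that almost surely $X^i_t=X^i_0-\lambda\int_0^tX^i_s\,ds+W^i_t$ for all $t\ge0$, with $W^i$ a standard Brownian motion independent of $X^i_0$. -/

import Mathlib

open MeasureTheory ProbabilityTheory Set
open scoped NNReal ENNReal

noncomputable section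

namespace Bernstein

/-! ### Processes indexed by `[0, T]` -/

section Processes

variable {ι Ω E : Type*} [Preorder ι] [MeasurableSpace E]

/-- The σ-algebra generated by `Z τ` for `τ ≤ s`. -/
@[reducible] def past (Z : ι → Ω → E) (s : ι) : MeasurableSpace Ω :=
  ⨆ τ : ι, ⨆ _ : τ ≤ s, MeasurableSpace.comap (Z τ) inferInstance

/-- The σ-algebra generated by `Z τ` for `τ ≥ t`. -/
@[reducible] def future (Z : ι → Ω → E) (t : ι) : MeasurableSpace Ω :=
  ⨆ τ : ι, ⨆ _ : t ≤ τ, MeasurableSpace.comap (Z τ) inferInstance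

/-- The σ-algebra generated by `Z s`. -/
@[reducible] def present (Z : ι → Ω → E) (s : ι) : MeasurableSpace Ω :=
  MeasurableSpace.comap (Z s) inferInstance

/-- The Bernstein (reciprocal) property:
`𝔼(f(Z_r) | F_s⁺ ∨ F_t⁻) = 𝔼(f(Z_r) | Z_s, Z_t)` for `s < r < t` and bounded Borel `f`. -/
structure IsBernsteinProcess [MeasurableSpace Ω] (Z : ι → Ω → E) (P : Measure Ω) : Prop where
  measurable : ∀ t, Measurable (Z t)
  condExp_eq : ∀ s r t : ι, s < r → r < t →
    ∀ f : E → ℝ, Measurable f → (∃ C : ℝ, ∀ x, |f x| ≤ C) →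
      P[fun ω ↦ f (Z r ω) | past Z s ⊔ future Z t]
        =ᵐ[P] P[fun ω ↦ f (Z r ω) | present Z s ⊔ present Z t]

/-- The Markov property:
`𝔼(f(Z_t) | F_s⁺) = 𝔼(f(Z_t) | Z_s)` for `s ≤ t` and bounded Borel `f`. -/
structure IsMarkovProcess [MeasurableSpace Ω] (Z : ι → Ω → E) (P : Measure Ω) : Prop where
  measurable : ∀ t, Measurable (Z t)
  condExp_eq : ∀ s t : ι, s ≤ t →
    ∀ f : E → ℝ, Measurable f → (∃ C : ℝ, ∀ x, |f x| ≤ C) →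
      P[fun ω ↦ f (Z t ω) | past Z s] =ᵐ[P] P[fun ω ↦ f (Z t ω) | present Z s]

end Processes

/-! ### The Markovian Bernstein process attached to a kernel and initial-final measures -/

section Association

variable {N : ℕ}

/-- The density `p(x,t; z,r; y,s) = g(x,t-r,z) g(z,r-s,y) / g(x,t-s,y)`. -/
def bernsteinDensity (g : EuclideanSpace ℝ (Fin N) → ℝ → EuclideanSpace ℝ (Fin N) → ℝ)
    (x : EuclideanSpace ℝ (Fin N)) (t : ℝ) (z : EuclideanSpace ℝ (Fin N)) (r : ℝ)
    (y : EuclideanSpace ℝ (Fin N)) (s : ℝ) : ℝ :=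
  g x (t - r) z * g z (r - s) y / g x (t - s) y

/-- The transition function `P(x,t; E,r; y,s) = ∫_E p(x,t; z,r; y,s) dz`. -/
def bernsteinTransition (g : EuclideanSpace ℝ (Fin N) → ℝ → EuclideanSpace ℝ (Fin N) → ℝ)
    (x : EuclideanSpace ℝ (Fin N)) (t : ℝ) (E : Set (EuclideanSpace ℝ (Fin N))) (r : ℝ)
    (y : EuclideanSpace ℝ (Fin N)) (s : ℝ) : ℝ :=
  ∫ z in E, bernsteinDensity g x t z r y s

/-- The measure `μ(F) = ∫_F g(x,T,y) d(φ₀ ⊗ ψ_T)(x,y)`. -/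
def markovianMeasure (g : EuclideanSpace ℝ (Fin N) → ℝ → EuclideanSpace ℝ (Fin N) → ℝ) (T : ℝ)
    (φ₀ ψT : Measure (EuclideanSpace ℝ (Fin N))) :
    Measure (EuclideanSpace ℝ (Fin N) × EuclideanSpace ℝ (Fin N)) :=
  (φ₀.prod ψT).withDensity (fun q ↦ ENNReal.ofReal (g q.1 T q.2))

/-- `Z` is, under `P`, a Bernstein process whose transition function is the one built from the
kernel `g`, and for which the joint law of `(Z_0, Z_T)` is the Markovian measure built from `g`
and from the initial-final measures `φ₀`, `ψT`. -/
structure IsAssociatedBernsteinProcess {Ω : Type*} [MeasurableSpace Ω] {T : ℝ} (hT : 0 < T)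
    (g : EuclideanSpace ℝ (Fin N) → ℝ → EuclideanSpace ℝ (Fin N) → ℝ)
    (φ₀ ψT : Measure (EuclideanSpace ℝ (Fin N)))
    (Z : Icc (0 : ℝ) T → Ω → EuclideanSpace ℝ (Fin N)) (P : Measure Ω) : Prop where
  isBernsteinProcess : IsBernsteinProcess Z P
  transition : ∀ s r t : Icc (0 : ℝ) T, s < r → r < t →
    ∀ E : Set (EuclideanSpace ℝ (Fin N)), MeasurableSet E →
      P[(Z r ⁻¹' E).indicator (fun _ ↦ (1 : ℝ)) | present Z s ⊔ present Z t]
        =ᵐ[P] fun ω ↦ bernsteinTransition g (Z t ω) t E r (Z s ω) s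
  jointLaw : P.map (fun ω ↦
      (Z ⟨0, left_mem_Icc.2 hT.le⟩ ω, Z ⟨T, right_mem_Icc.2 hT.le⟩ ω)) =
    markovianMeasure g T φ₀ ψT

end Association

/-! ### The harmonic data -/

/-- Mehler's `N`-dimensional kernel, the Green function of `∂ₜu = ½ Δu - ½ λ² |x|² u`. -/
def mehlerKernel (N : ℕ) (lam : ℝ) (x : EuclideanSpace ℝ (Fin N)) (t : ℝ)
    (y : EuclideanSpace ℝ (Fin N)) : ℝ :=
  (lam / (2 * Real.pi * Real.sinh (lam * t))) ^ ((N : ℝ) / 2) *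
    Real.exp (-(lam * (Real.cosh (lam * t) * (‖x‖ ^ 2 + ‖y‖ ^ 2) - 2 * inner ℝ x y)) /
      (2 * Real.sinh (lam * t)))

/-- The density `(λ e^{λT} / π)^{N/4} e^{-λ|x|²/2}` of the initial and of the final datum. -/
def groundStateDensity (N : ℕ) (lam T : ℝ) (x : EuclideanSpace ℝ (Fin N)) : ℝ :=
  (lam * Real.exp (lam * T) / Real.pi) ^ ((N : ℝ) / 4) * Real.exp (-(lam * ‖x‖ ^ 2) / 2)

/-- The initial and final datum, as a measure. -/
def groundStateMeasure (N : ℕ) (lam T : ℝ) : Measure (EuclideanSpace ℝ (Fin N)) :=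
  volume.withDensity (fun x ↦ ENNReal.ofReal (groundStateDensity N lam T x))

/-! ### Stationary Ornstein-Uhlenbeck processes -/

/-- A one-dimensional stationary Ornstein-Uhlenbeck process: a stationary, a.s. continuous solution
of `dX_t = -λ X_t dt + dW_t`, where `W` is a standard Brownian motion independent of `X_0`. -/
def IsStationaryOrnsteinUhlenbeck {Ω : Type*} [MeasurableSpace Ω] (lam : ℝ)
    (X : ℝ≥0 → Ω → ℝ) (P : Measure Ω) : Prop :=
  (∃ W : ℝ≥0 → Ω → ℝ, IsBrownianReal W P ∧
    IndepFun (X 0) (fun ω t ↦ W t ω) P ∧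
    ∀ᵐ ω ∂P, Continuous (fun t ↦ X t ω) ∧
      ∀ t : ℝ≥0, X t ω = X 0 ω - lam * (∫ s in (0 : ℝ)..t, X s.toNNReal ω) + W t ω) ∧
  ∀ h : ℝ≥0, IdentDistrib (fun ω (t : ℝ≥0) ↦ X (t + h) ω) (fun ω (t : ℝ≥0) ↦ X t ω) P P

end Bernstein

end

/-! The theorem follows from two facts: the vector of `N` independent stationary Ornstein–Uhlenbeck
processes satisfies (i)–(iii), and (i)–(iii) determine the law of the process. All listed properties
depend only on the law once each `Z t` is measurable, so it is enough to know them for the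
Ornstein–Uhlenbeck vector.

Verification (`IsOUVector.isAssociatedBernsteinProcess`). For `s < r < t` the function `exp (-λ|· -
τ|)` solves `u'' = λ² u` on `[s, t]` whenever `τ ≤ s` or `τ ≥ t`, so it is the `sinh`-interpolation
of its values at `s` and `t`. Hence `Z r - (a Z t + b Z s)`, with `a, b` the interpolation
coefficients, is uncorrelated with, and by Gaussianity independent of, everything before `s` and
after `t`. Its Gaussian law is the one obtained by completing the square in the quotient of Mehler
kernels (`bernsteinDensity_mehlerKernel`). This gives (i) and (ii); `groundState_mul_mehlerKernel`
gives (iii).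

Uniqueness (`IsAssociatedBernsteinProcess.identDistrib`). Conversely, (i) and (ii) force that same
residual to be independent of the past of `s` and the future of `t`, with the same Gaussian law. In
a joint characteristic function one interior time can therefore be removed at the cost of an
explicit factor and a change of the remaining coefficients. By induction only the times `0` and `T`
remain, and (iii) fixes their joint law.

Construction (`exists_stationaryOrnsteinUhlenbeck`). An isometry `G` from `L²(ℝ)` into Gaussian
variables gives independent Brownian motions on `[0, 1]`, made continuous by chaining; then `X t =
exp (λt) B(exp (-2λt)) / √(2λ)`. That `X t - X 0 + λ ∫ X` is a Brownian motion independent of `X 0`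
reduces to inner products in the Hilbert space, because `G` carries Bochner integrals to pathwise
integrals. -/

noncomputable section

namespace Bernstein

/-! ### Isonormal Gaussian processes over a Hilbert space -/

section Isonormal

variable {Ω : Type*} [MeasurableSpace Ω] {P : Measure Ω} [IsProbabilityMeasure P]

lemma norm_exp_mul_I_sub_le (a b : ℝ) :
    ‖Complex.exp (a * Complex.I) - Complex.exp (b * Complex.I)‖ ≤ |a - b| := by
  have h : Complex.exp (a * Complex.I) - Complex.exp (b * Complex.I)
      = Complex.exp (b * Complex.I) * (Complex.exp (Complex.I * ((a - b : ℝ) : ℂ)) - 1) := by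
    rw [mul_sub, ← Complex.exp_add]
    push_cast
    ring_nf
  rw [h, norm_mul, Complex.norm_exp_ofReal_mul_I, one_mul]
  exact Real.norm_exp_I_mul_ofReal_sub_one_le

lemma integrable_exp_mul_I {f : Ω → ℝ} (hf : AEStronglyMeasurable f P) :
    Integrable (fun ω ↦ Complex.exp (f ω * Complex.I)) P := by
  refine Integrable.of_bound (C := 1) ?_ (ae_of_all _ fun ω ↦ (Complex.norm_exp_ofReal_mul_I _).le)
  exact (Complex.continuous_exp.comp (by fun_prop :
    Continuous fun x : ℝ ↦ (x : ℂ) * Complex.I)).comp_aestronglyMeasurable hf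

lemma norm_charFun_sub_le {f g : Ω → ℝ} (hf : Integrable f P) (hg : Integrable g P) (t : ℝ) :
    ‖(∫ ω, Complex.exp ((t * f ω : ℝ) * Complex.I) ∂P) -
      ∫ ω, Complex.exp ((t * g ω : ℝ) * Complex.I) ∂P‖ ≤ |t| * ∫ ω, |f ω - g ω| ∂P := by
  rw [← integral_sub (integrable_exp_mul_I (hf.1.const_mul t))
    (integrable_exp_mul_I (hg.1.const_mul t)), ← integral_const_mul]
  refine norm_integral_le_of_norm_le ((hf.sub hg).abs.const_mul _) (ae_of_all _ fun ω ↦ ?_)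
  refine (norm_exp_mul_I_sub_le _ _).trans ?_
  rw [← mul_sub, abs_mul]

lemma integral_abs_le_norm_Lp (f : Lp ℝ 2 P) : ∫ ω, |f ω| ∂P ≤ ‖f‖ := by
  have h1 : eLpNorm f 1 P ≤ eLpNorm f 2 P :=
    eLpNorm_le_eLpNorm_of_exponent_le (by norm_num) (Lp.aestronglyMeasurable f)
  have h2 : ∫ ω, |f ω| ∂P = (eLpNorm f 1 P).toReal := by
    rw [eLpNorm_one_eq_lintegral_enorm, ← integral_norm_eq_lintegral_enorm (Lp.aestronglyMeasurable f)]
    rfl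
  rw [h2, Lp.norm_def]
  exact ENNReal.toReal_mono (Lp.eLpNorm_ne_top f) h1

/-- The map `x ↦ exp (itx)` is `|t|`-Lipschitz and, for a probability measure, the `L¹` norm is at
most the `L²` norm. -/
lemma continuous_charFun_Lp (t : ℝ) :
    Continuous fun f : Lp ℝ 2 P ↦ ∫ ω, Complex.exp ((t * f ω : ℝ) * Complex.I) ∂P := by
  refine (LipschitzWith.of_dist_le_mul (K := ⟨|t|, abs_nonneg t⟩) fun f g ↦ ?_).continuous
  rw [dist_eq_norm, dist_eq_norm]
  have hi (f : Lp ℝ 2 P) : Integrable f P := (Lp.memLp f).integrable (by norm_num)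
  refine (norm_charFun_sub_le (hi f) (hi g) t).trans ?_
  refine mul_le_mul_of_nonneg_left ?_ (abs_nonneg t)
  refine le_trans (le_of_eq (integral_congr_ae ?_)) (integral_abs_le_norm_Lp (f - g))
  filter_upwards [Lp.coeFn_sub f g] with ω h
  rw [h]; rfl

/-- Turns Gaussianity into one equation per `t`; both sides are continuous in `L²`, which makes the
condition closed. -/
lemma hasLaw_gaussianReal_iff {f : Ω → ℝ} (hf : AEMeasurable f P) (v : ℝ≥0) :
    HasLaw f (gaussianReal 0 v) P ↔
      ∀ t : ℝ, ∫ ω, Complex.exp ((t * f ω : ℝ) * Complex.I) ∂P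
        = Complex.exp (-(v * t ^ 2 / 2 : ℝ)) := by
  have key (t : ℝ) : charFun (P.map f) t = ∫ ω, Complex.exp ((t * f ω : ℝ) * Complex.I) ∂P := by
    rw [charFun_apply_real, integral_map hf (by fun_prop)]
    simp
  have key2 (t : ℝ) : charFun (gaussianReal 0 v) t = Complex.exp (-(v * t ^ 2 / 2 : ℝ)) := by
    rw [charFun_gaussianReal]
    simp
  constructor
  · intro h t
    rw [← key, h.map_eq, key2]
  · intro h
    refine ⟨hf, ?_⟩
    have := Measure.isProbabilityMeasure_map hf
    refine Measure.ext_of_charFun (funext fun t ↦ ?_)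
    rw [key, key2, h]

/-- The elements of `L²` which are centered Gaussian variables form a closed set. -/
lemma isClosed_setOf_hasLaw_gaussianReal :
    IsClosed {f : Lp ℝ 2 P | HasLaw f (gaussianReal 0 (‖f‖₊ ^ 2)) P} := by
  have : {f : Lp ℝ 2 P | HasLaw f (gaussianReal 0 (‖f‖₊ ^ 2)) P} =
      ⋂ t : ℝ, {f : Lp ℝ 2 P | ∫ ω, Complex.exp ((t * f ω : ℝ) * Complex.I) ∂P
        = Complex.exp (-(((‖f‖₊ ^ 2 : ℝ≥0) : ℝ) * t ^ 2 / 2 : ℝ))} := by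
    ext f
    simp only [mem_ofPred_eq, mem_iInter]
    exact hasLaw_gaussianReal_iff (Lp.aestronglyMeasurable f).aemeasurable _
  rw [this]
  refine isClosed_iInter fun t ↦ isClosed_eq (continuous_charFun_Lp t) ?_
  fun_prop

omit [IsProbabilityMeasure P] in
lemma norm_sq_eq_integral (f : Lp ℝ 2 P) : ‖f‖ ^ 2 = ∫ ω, f ω ^ 2 ∂P := by
  rw [← real_inner_self_eq_norm_sq, L2.inner_def]
  refine integral_congr_ae (ae_of_all _ fun ω ↦ ?_)
  simp [sq]

omit [IsProbabilityMeasure P] in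
lemma hasLaw_of_hasGaussianLaw (f : Lp ℝ 2 P) (h : HasGaussianLaw f P) (h0 : ∫ ω, f ω ∂P = 0) :
    HasLaw f (gaussianReal 0 (‖f‖₊ ^ 2)) P := by
  refine ⟨h.aemeasurable, ?_⟩
  rw [h.map_eq_gaussianReal, h0]
  congr 1
  rw [variance_of_integral_eq_zero h.aemeasurable h0]
  have : ∫ ω, f ω ^ 2 ∂P = ((‖f‖₊ ^ 2 : ℝ≥0) : ℝ) := by
    rw [← norm_sq_eq_integral]; simp
  rw [this, Real.toNNReal_coe]

/-- Existence of an isonormal Gaussian process over a Hilbert space. -/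
theorem exists_isonormal (H : Type) [NormedAddCommGroup H] [InnerProductSpace ℝ H]
    [CompleteSpace H] :
    ∃ (Ω : Type) (_ : MeasurableSpace Ω) (P : Measure Ω) (_ : IsProbabilityMeasure P)
      (G : H →ₗᵢ[ℝ] Lp ℝ 2 P), ∀ h, HasLaw (G h) (gaussianReal 0 (‖h‖₊ ^ 2)) P := by
  classical
  obtain ⟨w, b, -⟩ := exists_hilbertBasis ℝ H
  let P : Measure (w → ℝ) := Measure.infinitePi fun _ ↦ gaussianReal 0 1
  have hlaw (i : w) : HasLaw (fun ω : w → ℝ ↦ ω i) (gaussianReal 0 1) P :=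
    (measurePreserving_eval_infinitePi (fun _ : w ↦ gaussianReal 0 1) i).hasLaw
  have hind : iIndepFun (fun (i : w) (ω : w → ℝ) ↦ ω i) P :=
    iIndepFun_infinitePi (X := fun _ x ↦ x) (by fun_prop)
  have hmem (i : w) : MemLp (fun ω : w → ℝ ↦ ω i) 2 P := (hlaw i).hasGaussianLaw.memLp_two
  have hmean (i : w) : ∫ ω : w → ℝ, ω i ∂P = 0 := by
    rw [(hlaw i).integral_eq, integral_id_gaussianReal]
  let v (i : w) : Lp ℝ 2 P := (hmem i).toLp
  have hv : Orthonormal ℝ v := by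
    have hin (i j : w) : inner ℝ (v i) (v j) = ∫ ω : w → ℝ, ω j * ω i ∂P := by
      rw [L2.inner_def]
      refine integral_congr_ae ?_
      filter_upwards [(hmem i).coeFn_toLp, (hmem j).coeFn_toLp] with ω h1 h2
      simp [v, h1, h2]
    rw [orthonormal_iff_ite]
    intro i j
    rw [hin]
    split_ifs with hij
    · subst hij
      have h := variance_of_integral_eq_zero (hlaw i).aemeasurable (hmean i)
      rw [(hlaw i).variance_eq, variance_id_gaussianReal] at h
      simp only [NNReal.coe_one] at h
      rw [h]
      simp [sq]
    · rw [(hind.indepFun (Ne.symm hij)).integral_fun_mul_eq_mul_integral (hlaw j).aemeasurable.aestronglyMeasurable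
        (hlaw i).aemeasurable.aestronglyMeasurable, hmean, zero_mul]
  have hfin (s : Finset w) (c : w → ℝ) : HasLaw (∑ i ∈ s, c i • v i : Lp ℝ 2 P)
      (gaussianReal 0 (‖(∑ i ∈ s, c i • v i : Lp ℝ 2 P)‖₊ ^ 2)) P := by
    have hae : (∑ i ∈ s, c i • v i : Lp ℝ 2 P) =ᵐ[P] fun ω ↦ ∑ i ∈ s, c i * ω i := by
      have h1 : ∀ᵐ ω ∂P, ∀ i ∈ s, (c i • v i : Lp ℝ 2 P) ω = c i * ω i := by
        refine (Finset.eventually_all _).2 fun i _ ↦ ?_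
        filter_upwards [Lp.coeFn_smul (c i) (v i), (hmem i).coeFn_toLp] with ω h h'
        rw [h, Pi.smul_apply, h', smul_eq_mul]
      filter_upwards [Lp.coeFn_finsetSum s fun i ↦ c i • v i, h1] with ω h h'
      rw [h, Finset.sum_apply]
      exact Finset.sum_congr rfl h'
    have hG : HasGaussianLaw (fun ω : w → ℝ ↦ ∑ i ∈ s, c i * ω i) P := by
      have h1 : HasGaussianLaw (fun (ω : w → ℝ) (i : s) ↦ c i * ω i) P := by
        refine iIndepFun.hasGaussianLaw (X := fun (i : s) (ω : w → ℝ) ↦ c i * ω i)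
          (fun i ↦ (hlaw i).hasGaussianLaw.fun_smul (c i)) ?_
        exact (hind.precomp (g := fun i : s ↦ (i : w)) Subtype.val_injective).comp
          (fun i x ↦ c (i : w) * x) (fun i ↦ by fun_prop)
      have h2 := h1.fun_sum
      have h3 (ω : w → ℝ) : ∑ i : s, c i * ω i = ∑ i ∈ s, c i * ω i :=
        Finset.sum_coe_sort s fun i ↦ c i * ω i
      simpa only [h3] using h2
    refine hasLaw_of_hasGaussianLaw _ (hG.congr hae.symm) ?_
    rw [integral_congr_ae hae, integral_finsetSum _ fun i _ ↦
      ((hlaw i).hasGaussianLaw.integrable.const_mul _)]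
    simp [integral_const_mul, hmean]
  -- The isometry expands `h` in the Hilbert basis and replaces each basis vector by the
  -- corresponding independent standard Gaussian coordinate.
  refine ⟨w → ℝ, inferInstance, P, inferInstance,
    hv.orthogonalFamily.linearIsometry.comp b.repr.toLinearIsometry, fun h ↦ ?_⟩
  set f := (hv.orthogonalFamily.linearIsometry.comp b.repr.toLinearIsometry) h with hf
  have hnorm : ‖h‖₊ = ‖f‖₊ := by rw [hf, LinearIsometry.nnnorm_map]
  rw [hnorm]
  -- The finite partial sums are Gaussian by independence and converge in `L²`.
  refine isClosed_setOf_hasLaw_gaussianReal.mem_of_tendsto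
    (hv.orthogonalFamily.hasSum_linearIsometry (b.repr h)) (Filter.Eventually.of_forall fun s ↦ ?_)
  exact hfin s (b.repr h)

end Isonormal

/-! ### Gaussian families inside an isonormal space -/

section IsonormalProcess

variable {H : Type*} [NormedAddCommGroup H] [InnerProductSpace ℝ H]
  {Ω : Type*} [MeasurableSpace Ω] {P : Measure Ω}

/-- An isometry from a Hilbert space to `L²` whose values are centered Gaussian variables. -/
def IsIsonormal (G : H →ₗᵢ[ℝ] Lp ℝ 2 P) : Prop :=
  ∀ h, HasLaw (G h) (gaussianReal 0 (‖h‖₊ ^ 2)) P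

variable {G : H →ₗᵢ[ℝ] Lp ℝ 2 P}

lemma IsIsonormal.hasLaw (hG : IsIsonormal G) {X : Ω → ℝ} {x : H} (hX : X =ᵐ[P] G x) :
    HasLaw X (gaussianReal 0 (‖x‖₊ ^ 2)) P :=
  (hG x).congr hX

lemma IsIsonormal.integral_eq_zero (hG : IsIsonormal G) {X : Ω → ℝ} {x : H} (hX : X =ᵐ[P] G x) :
    ∫ ω, X ω ∂P = 0 := by
  rw [(hG.hasLaw hX).integral_eq, integral_id_gaussianReal]

lemma IsIsonormal.memLp (hG : IsIsonormal G) {X : Ω → ℝ} {x : H} (hX : X =ᵐ[P] G x) :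
    MemLp X 2 P := (hG.hasLaw hX).hasGaussianLaw.memLp_two

lemma integral_mul_eq_inner {X Y : Ω → ℝ} {x y : H} (hX : X =ᵐ[P] G x)
    (hY : Y =ᵐ[P] G y) : ∫ ω, X ω * Y ω ∂P = inner ℝ x y := by
  rw [← G.inner_map_map, L2.inner_def]
  refine integral_congr_ae ?_
  filter_upwards [hX, hY] with ω h1 h2
  simp [h1, h2, mul_comm]

lemma IsIsonormal.covariance_eq_inner [IsProbabilityMeasure P] (hG : IsIsonormal G) {X Y : Ω → ℝ} {x y : H}
    (hX : X =ᵐ[P] G x) (hY : Y =ᵐ[P] G y) : cov[X, Y; P] = inner ℝ x y := by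
  rw [covariance_eq_sub (hG.memLp hX) (hG.memLp hY), hG.integral_eq_zero hX, zero_mul, sub_zero]
  exact integral_mul_eq_inner hX hY

lemma isonormal_sum {κ : Type*} (s : Finset κ) (c : κ → ℝ) {X : κ → Ω → ℝ} {x : κ → H}
    (hX : ∀ i, X i =ᵐ[P] G (x i)) :
    (fun ω ↦ ∑ i ∈ s, c i * X i ω) =ᵐ[P] G (∑ i ∈ s, c i • x i) := by
  rw [map_sum]
  have h1 : ∀ᵐ ω ∂P, ∀ i ∈ s, G (c i • x i) ω = c i * X i ω := by
    refine (Finset.eventually_all _).2 fun i _ ↦ ?_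
    rw [map_smul]
    filter_upwards [Lp.coeFn_smul (c i) (G (x i)), hX i] with ω h h'
    rw [h, Pi.smul_apply, h', smul_eq_mul]
  filter_upwards [Lp.coeFn_finsetSum s fun i ↦ G (c i • x i), h1] with ω h h'
  rw [h, Finset.sum_apply]
  exact (Finset.sum_congr rfl h').symm

lemma isonormal_strongDual {κ : Type*} {X : κ → Ω → ℝ} {x : κ → H} (hX : ∀ i, X i =ᵐ[P] G (x i))
    [Fintype κ] [DecidableEq κ] (L : StrongDual ℝ (κ → ℝ)) :
    (fun ω ↦ L (X · ω)) =ᵐ[P] G (∑ i, L (Pi.single i 1) • x i) := by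
  refine Filter.EventuallyEq.trans (ae_of_all _ fun ω ↦ ?_)
    (isonormal_sum Finset.univ (fun i ↦ L (Pi.single i 1)) hX)
  simp only
  rw [← L.sum_comp_single]
  refine Finset.sum_congr rfl fun i _ ↦ ?_
  have : Pi.single i (X i ω) = (X i ω) • (Pi.single i 1 : κ → ℝ) := by
    rw [← Pi.single_smul, smul_eq_mul, mul_one]
  simp [this, mul_comm]

/-- A linear functional of finitely many `X i` is again almost everywhere a value of `G`, hence
Gaussian. -/
lemma IsIsonormal.isGaussianProcess (hG : IsIsonormal G) {κ : Type*} {X : κ → Ω → ℝ} {x : κ → H}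
    (hX : ∀ i, X i =ᵐ[P] G (x i)) : IsGaussianProcess X P where
  hasGaussianLaw I := by
    classical
    have hm : AEMeasurable (fun ω ↦ I.restrict (X · ω)) P :=
      aemeasurable_pi_lambda _ fun i ↦ (hG.hasLaw (hX i)).aemeasurable
    refine ⟨⟨fun L ↦ ?_⟩⟩
    have hL : HasGaussianLaw (L ∘ fun ω ↦ I.restrict (X · ω)) P :=
      (hG.hasLaw (isonormal_strongDual (X := fun i : I ↦ X i) (fun i ↦ hX i) L)).hasGaussianLaw
    rw [AEMeasurable.map_map_of_aemeasurable (by fun_prop) hm, hL.map_eq_gaussianReal,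
      integral_map hm (by fun_prop), variance_map (by fun_prop) hm]
    rfl

/-- Two processes in an isonormal space with the same covariances have the same law. -/
lemma IsIsonormal.identDistrib [IsProbabilityMeasure P] (hG : IsIsonormal G) {κ : Type*}
    {X Y : κ → Ω → ℝ} {x y : κ → H} (hX : ∀ i, X i =ᵐ[P] G (x i)) (hY : ∀ i, Y i =ᵐ[P] G (y i))
    (hXm : ∀ i, Measurable (X i)) (hYm : ∀ i, Measurable (Y i))
    (h : ∀ i j, inner ℝ (x i) (x j) = inner ℝ (y i) (y j)) :
    IdentDistrib (fun ω i ↦ X i ω) (fun ω i ↦ Y i ω) P P := by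
  classical
  have hXm' : Measurable fun ω i ↦ X i ω := measurable_pi_lambda _ hXm
  have hYm' : Measurable fun ω i ↦ Y i ω := measurable_pi_lambda _ hYm
  rw [identDistrib_iff_forall_finset_identDistrib hXm'.aemeasurable hYm'.aemeasurable]
  intro I
  have hXI : Measurable fun ω ↦ I.restrict (X · ω) := measurable_pi_lambda _ fun i ↦ hXm i
  have hYI : Measurable fun ω ↦ I.restrict (Y · ω) := measurable_pi_lambda _ fun i ↦ hYm i
  refine ⟨hXI.aemeasurable, hYI.aemeasurable, ?_⟩
  have := Measure.isProbabilityMeasure_map (μ := P) hXI.aemeasurable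
  have := Measure.isProbabilityMeasure_map (μ := P) hYI.aemeasurable
  refine Measure.ext_of_charFunDual (funext fun L ↦ ?_)
  rw [charFunDual_eq_charFun_map_one, charFunDual_eq_charFun_map_one,
    Measure.map_map (by fun_prop) hXI, Measure.map_map (by fun_prop) hYI]
  have h1 := (hG.hasLaw (isonormal_strongDual (X := fun i : I ↦ X i) (fun i ↦ hX i) L)).map_eq
  have h2 := (hG.hasLaw (isonormal_strongDual (X := fun i : I ↦ Y i) (fun i ↦ hY i) L)).map_eq
  -- The variance of a linear combination depends only on the Gram matrix.
  have h3 : ‖∑ i : I, L (Pi.single i 1) • x i‖₊ ^ 2 = ‖∑ i : I, L (Pi.single i 1) • y i‖₊ ^ 2 := by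
    ext
    push_cast
    simp only [← real_inner_self_eq_norm_sq, sum_inner, inner_sum, inner_smul_left,
      inner_smul_right, h]
  have e1 : (L ∘ fun ω ↦ I.restrict (X · ω)) = fun ω ↦ L fun i : I ↦ X i ω := rfl
  have e2 : (L ∘ fun ω ↦ I.restrict (Y · ω)) = fun ω ↦ L fun i : I ↦ Y i ω := rfl
  rw [e1, e2, h1, h2, h3]

/-- The fourth moment of a centered Gaussian variable is proportional to its squared variance. -/
lemma lintegral_pow_four_gaussianReal (v : ℝ≥0) :
    ∫⁻ x, ENNReal.ofReal (x ^ 4) ∂gaussianReal 0 v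
      = ENNReal.ofReal ((∫ x, x ^ 4 ∂gaussianReal 0 1) * (v : ℝ) ^ 2) := by
  have hint : Integrable (fun x : ℝ ↦ x ^ 4) (gaussianReal 0 1) := by
    have h := (memLp_id_gaussianReal (μ := 0) (v := 1) 4).integrable_norm_pow (by norm_num)
    refine h.congr (ae_of_all _ fun x ↦ ?_)
    simp [Even.pow_abs (show Even 4 by decide)]
  have hv : gaussianReal 0 v = (gaussianReal 0 1).map (√v * ·) := by
    rw [gaussianReal_map_const_mul]
    congr 1
    · simp
    · ext; simp
  rw [hv, lintegral_map (by fun_prop) (by fun_prop), ← integral_mul_const,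
    ofReal_integral_eq_lintegral_ofReal (hint.mul_const _) (ae_of_all _ fun x ↦ by positivity)]
  refine lintegral_congr fun x ↦ ?_
  congr 1
  have : √(v : ℝ) ^ 2 = v := Real.sq_sqrt v.2
  rw [mul_pow, show √(v : ℝ) ^ 4 = (√(v : ℝ) ^ 2) ^ 2 by ring, this]
  ring

end IsonormalProcess

/-! ### Dyadic chaining and continuous modifications -/

section Chaining

open Filter Topology

lemma floor_two_pow_succ (n : ℕ) {t : ℝ} (ht : 0 ≤ t) :
    ⌊2 ^ (n + 1) * t⌋₊ = 2 * ⌊2 ^ n * t⌋₊ ∨ ⌊2 ^ (n + 1) * t⌋₊ = 2 * ⌊2 ^ n * t⌋₊ + 1 := by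
  have h1 := Nat.floor_le (show 0 ≤ 2 ^ n * t by positivity)
  have h2 := Nat.lt_floor_add_one (2 ^ n * t)
  have h3 : 2 ^ (n + 1) * t = 2 * (2 ^ n * t) := by ring
  have h4 : 2 * ⌊2 ^ n * t⌋₊ ≤ ⌊2 ^ (n + 1) * t⌋₊ := by
    refine Nat.le_floor ?_
    push_cast
    linarith
  have h5 : ⌊2 ^ (n + 1) * t⌋₊ < 2 * ⌊2 ^ n * t⌋₊ + 2 := by
    refine (Nat.floor_lt (by positivity)).2 ?_
    push_cast
    linarith
  omega

/-- The value of `f` at the dyadic number of level `n` preceding `t`. -/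
def dyadicStep (f : ℝ → ℝ) (n : ℕ) (t : ℝ) : ℝ := f (⌊2 ^ n * t⌋₊ / 2 ^ n)

variable {f : ℝ → ℝ} {K ρ : ℝ}

/-- Refining the grid either keeps the dyadic point or moves it by one step of level `n + 1`. -/
lemma dist_dyadicStep_succ_le
    (hf : ∀ n k : ℕ, |f ((k + 1 : ℕ) / 2 ^ n) - f (k / 2 ^ n)| ≤ K * ρ ^ n) (hK : 0 ≤ K) (hρ : 0 ≤ ρ)
    {t : ℝ} (ht : 0 ≤ t) (n : ℕ) :
    dist (dyadicStep f n t) (dyadicStep f (n + 1) t) ≤ (K * ρ) * ρ ^ n := by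
  have e : (⌊2 ^ n * t⌋₊ : ℝ) / 2 ^ n = (2 * ⌊2 ^ n * t⌋₊ : ℕ) / 2 ^ (n + 1) := by
    push_cast
    field_simp
    ring
  unfold dyadicStep
  rcases floor_two_pow_succ n ht with h | h
  · rw [h, ← e, dist_self]
    positivity
  · rw [h, e, dist_comm, Real.dist_eq]
    refine (hf (n + 1) _).trans (le_of_eq (by ring))

lemma abs_dyadicStep_sub_le
    (hf : ∀ n k : ℕ, |f ((k + 1 : ℕ) / 2 ^ n) - f (k / 2 ^ n)| ≤ K * ρ ^ n) (hK : 0 ≤ K) (hρ : 0 ≤ ρ)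
    {s t : ℝ} (hs : 0 ≤ s) (hst : s ≤ t) (n : ℕ) (h : t - s ≤ (1 / 2) ^ n) :
    |dyadicStep f n t - dyadicStep f n s| ≤ K * ρ ^ n := by
  have ht := hs.trans hst
  have h1 : ⌊2 ^ n * s⌋₊ ≤ ⌊2 ^ n * t⌋₊ := Nat.floor_mono (by gcongr)
  have h2 : ⌊2 ^ n * t⌋₊ < ⌊2 ^ n * s⌋₊ + 2 := by
    refine (Nat.floor_lt (by positivity)).2 ?_
    have h3 := Nat.lt_floor_add_one (2 ^ n * s)
    have h4 : 2 ^ n * (t - s) ≤ 1 := by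
      calc 2 ^ n * (t - s) ≤ 2 ^ n * (1 / 2) ^ n := by gcongr
        _ = 1 := by rw [← mul_pow]; norm_num
    push_cast
    linarith
  unfold dyadicStep
  rcases (by omega : ⌊2 ^ n * t⌋₊ = ⌊2 ^ n * s⌋₊ ∨ ⌊2 ^ n * t⌋₊ = ⌊2 ^ n * s⌋₊ + 1) with h3 | h3
  · rw [h3, sub_self, abs_zero]
    positivity
  · rw [h3]
    exact hf n _

/-- The geometric bound makes the dyadic values Cauchy, with tail of order `ρ ^ n`. Points at
distance at most `2⁻ⁿ` have equal or adjacent dyadic points at level `n`, so the limit has a modulus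
of continuity of the same order. -/
lemma exists_continuousOn_tendsto_dyadicStep
    (hf : ∀ n k : ℕ, |f ((k + 1 : ℕ) / 2 ^ n) - f (k / 2 ^ n)| ≤ K * ρ ^ n) (hK : 0 ≤ K) (hρ : 0 ≤ ρ)
    (hρ1 : ρ < 1) :
    ∃ g : ℝ → ℝ, ContinuousOn g (Ici 0) ∧
      ∀ t, 0 ≤ t → Tendsto (fun n ↦ dyadicStep f n t) atTop (𝓝 (g t)) := by
  have hex (t : ℝ) : ∃ y, 0 ≤ t → Tendsto (fun n ↦ dyadicStep f n t) atTop (𝓝 y) := by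
    by_cases ht : 0 ≤ t
    · obtain ⟨y, hy⟩ := cauchySeq_tendsto_of_complete
        (cauchySeq_of_le_geometric ρ (K * ρ) hρ1 (dist_dyadicStep_succ_le hf hK hρ ht))
      exact ⟨y, fun _ ↦ hy⟩
    · exact ⟨0, fun h ↦ absurd h ht⟩
  choose g hg using hex
  refine ⟨g, ?_, hg⟩
  have hd (t : ℝ) (ht : 0 ≤ t) (n : ℕ) : dist (dyadicStep f n t) (g t) ≤ K * ρ * ρ ^ n / (1 - ρ) :=
    dist_le_of_le_geometric_of_tendsto ρ (K * ρ) hρ1 (dist_dyadicStep_succ_le hf hK hρ ht) (hg t ht) n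
  have hmod (n : ℕ) (s t : ℝ) (hs : 0 ≤ s) (ht : 0 ≤ t) (h : |t - s| ≤ (1 / 2) ^ n) :
      dist (g t) (g s) ≤ (2 * (K * ρ / (1 - ρ)) + K) * ρ ^ n := by
    have key : |dyadicStep f n t - dyadicStep f n s| ≤ K * ρ ^ n := by
      rcases le_total s t with hst | hst
      · exact abs_dyadicStep_sub_le hf hK hρ hs hst n (le_of_abs_le h)
      · rw [abs_sub_comm]
        rw [abs_sub_comm] at h
        exact abs_dyadicStep_sub_le hf hK hρ ht hst n (le_of_abs_le h)
    calc dist (g t) (g s) ≤ dist (g t) (dyadicStep f n t)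
          + dist (dyadicStep f n t) (dyadicStep f n s) + dist (dyadicStep f n s) (g s) :=
          dist_triangle4 _ _ _ _
      _ ≤ K * ρ * ρ ^ n / (1 - ρ) + K * ρ ^ n + K * ρ * ρ ^ n / (1 - ρ) := by
          gcongr
          · rw [dist_comm]; exact hd t ht n
          · exact key
          · exact hd s hs n
      _ = _ := by ring
  have hlim : Tendsto (fun n ↦ (2 * (K * ρ / (1 - ρ)) + K) * ρ ^ n) atTop (𝓝 0) := by
    simpa using (tendsto_pow_atTop_nhds_zero_of_lt_one hρ hρ1).const_mul (2 * (K * ρ / (1 - ρ)) + K)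
  intro s hs
  rw [Metric.continuousWithinAt_iff]
  intro ε hε
  obtain ⟨n, hn⟩ := (hlim.eventually (gt_mem_nhds hε)).exists
  refine ⟨(1 / 2) ^ n, by positivity, fun t ht hts ↦ (hmod n s t hs ht ?_).trans_lt hn⟩
  rw [Real.dist_eq] at hts
  exact hts.le

variable {Ω : Type*} [MeasurableSpace Ω] {P : Measure Ω}

/-- A Kolmogorov-type criterion: a process on `[0, 1]` whose increments have fourth moments of
order `|t - s|²` has a continuous modification. -/
theorem exists_continuous_modification {Y : ℝ → Ω → ℝ} (hY : ∀ t, Measurable (Y t)) {C : ℝ}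
    (hC0 : 0 ≤ C)
    (hC : ∀ s t, ∫⁻ ω, ENNReal.ofReal ((Y t ω - Y s ω) ^ 4) ∂P ≤ ENNReal.ofReal (C * (t - s) ^ 2)) :
    ∃ X : ℝ → Ω → ℝ, (∀ t, Measurable (X t)) ∧ (∀ ω, ContinuousOn (X · ω) (Icc 0 1)) ∧
      ∀ t ∈ Icc (0 : ℝ) 1, X t =ᵐ[P] Y t := by
  classical
  -- Freezing the process at time `1` makes all later dyadic increments vanish, so only `2 ^ n` of
  -- them matter at level `n`.
  let Z (t : ℝ) (ω : Ω) : ℝ := Y (min t 1) ω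
  have hZ (t : ℝ) : Measurable (Z t) := hY _
  have hZC (s t : ℝ) :
      ∫⁻ ω, ENNReal.ofReal ((Z t ω - Z s ω) ^ 4) ∂P ≤ ENNReal.ofReal (C * (t - s) ^ 2) := by
    refine (hC _ _).trans (ENNReal.ofReal_le_ofReal (mul_le_mul_of_nonneg_left ?_ hC0))
    exact sq_le_sq.2 (by simpa using abs_min_sub_min_le_max t 1 s 1)
  -- The target rate is `ρ = 9/10`, and the weight is `ρ ^ (-4n)`. There are `2 ^ n` increments with
  -- fourth moment at most `C 4⁻ⁿ`, so the expectation is at most `C (10000/13122) ^ n`, which is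
  -- summable because `ρ ^ 4 > 1/2`.
  let D (n : ℕ) (ω : Ω) : ℝ≥0∞ := ENNReal.ofReal ((10000 / 6561) ^ n) *
    ∑ k ∈ Finset.range (2 ^ n), ENNReal.ofReal ((Z ((k + 1 : ℕ) / 2 ^ n) ω - Z (k / 2 ^ n) ω) ^ 4)
  have hinc (n k : ℕ) : Measurable fun ω ↦
      ENNReal.ofReal ((Z ((k + 1 : ℕ) / 2 ^ n) ω - Z (k / 2 ^ n) ω) ^ 4) :=
    ENNReal.measurable_ofReal.comp (((hZ _).sub (hZ _)).pow_const 4)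
  have hD (n : ℕ) : Measurable (D n) :=
    (Finset.measurable_fun_sum _ fun k _ ↦ hinc n k).const_mul _
  have hDint (n : ℕ) : ∫⁻ ω, D n ω ∂P ≤ ENNReal.ofReal (C * (10000 / 13122) ^ n) := by
    rw [lintegral_const_mul _ (Finset.measurable_fun_sum _ fun k _ ↦ hinc n k),
      lintegral_finsetSum _ fun k _ ↦ hinc n k]
    calc _ ≤ ENNReal.ofReal ((10000 / 6561) ^ n) *
          ∑ k ∈ Finset.range (2 ^ n), ENNReal.ofReal (C * (1 / 4) ^ n) := by
          gcongr with k hk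
          refine (hZC _ _).trans (le_of_eq ?_)
          congr 2
          push_cast
          rw [← sub_div, add_sub_cancel_left, div_pow, ← pow_mul, mul_comm n 2, pow_mul, div_pow]
          norm_num
      _ = ENNReal.ofReal (C * (10000 / 13122) ^ n) := by
          rw [Finset.sum_const, Finset.card_range, nsmul_eq_mul]
          have h2 : ((2 ^ n : ℕ) : ℝ≥0∞) = ENNReal.ofReal (2 ^ n) := by
            rw [← ENNReal.ofReal_natCast]; push_cast; rfl
          rw [h2, ← ENNReal.ofReal_mul (by positivity), ← ENNReal.ofReal_mul (by positivity)]
          congr 1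
          have : (10000 / 13122 : ℝ) ^ n = (10000 / 6561) ^ n * (2 ^ n * (1 / 4) ^ n) := by
            rw [← mul_pow, ← mul_pow]; norm_num
          rw [this]
          ring
  have hsum : ∫⁻ ω, ∑' n, D n ω ∂P ≠ ∞ := by
    rw [lintegral_tsum fun n ↦ (hD n).aemeasurable]
    refine ne_top_of_le_ne_top ?_ (ENNReal.tsum_le_tsum hDint)
    rw [← ENNReal.ofReal_tsum_of_nonneg (fun n ↦ by positivity)
      ((summable_geometric_of_lt_one (by norm_num) (by norm_num)).mul_left C)]
    exact ENNReal.ofReal_ne_top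
  let A : Set Ω := {ω | ∑' n, D n ω < ∞}
  have hA : MeasurableSet A := measurableSet_lt (Measurable.tsum hD) measurable_const
  have hAae : ∀ᵐ ω ∂P, ω ∈ A := ae_lt_top (Measurable.tsum hD) hsum
  have hbound (ω : Ω) (hω : ω ∈ A) (n k : ℕ) :
      |Z ((k + 1 : ℕ) / 2 ^ n) ω - Z (k / 2 ^ n) ω| ≤
        ((∑' n, D n ω).toReal + 1) * (9 / 10) ^ n := by
    set M := (∑' n, D n ω).toReal with hM
    have hM0 : 0 ≤ M := ENNReal.toReal_nonneg
    rcases lt_or_ge k (2 ^ n) with hk | hk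
    · have h1 : ENNReal.ofReal ((10000 / 6561) ^ n *
          (Z ((k + 1 : ℕ) / 2 ^ n) ω - Z (k / 2 ^ n) ω) ^ 4) ≤ ∑' n, D n ω := by
        refine le_trans ?_ (ENNReal.le_tsum n)
        rw [ENNReal.ofReal_mul (by positivity)]
        refine mul_le_mul_right ?_ _
        exact Finset.single_le_sum (f := fun k : ℕ ↦
          ENNReal.ofReal ((Z ((k + 1 : ℕ) / 2 ^ n) ω - Z (k / 2 ^ n) ω) ^ 4))
          (fun _ _ ↦ zero_le) (Finset.mem_range.2 hk)
      have h2 := (ENNReal.ofReal_le_iff_le_toReal (ne_of_lt hω)).1 h1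
      rw [← hM] at h2
      set d := Z ((k + 1 : ℕ) / 2 ^ n) ω - Z (k / 2 ^ n) ω
      have h3 : d ^ 4 ≤ M * ((9 / 10) ^ n) ^ 4 := by
        have h4 : ((10000 / 6561 : ℝ) ^ n) * ((9 / 10) ^ n) ^ 4 = 1 := by
          rw [← pow_mul, mul_comm n 4, pow_mul, ← mul_pow]; norm_num
        calc d ^ 4 = (10000 / 6561 : ℝ) ^ n * d ^ 4 * ((9 / 10) ^ n) ^ 4 := by
              linear_combination (-d ^ 4) * h4
          _ ≤ _ := by gcongr
      have h5 : |d| ^ 4 ≤ ((M + 1) * (9 / 10) ^ n) ^ 4 := by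
        rw [Even.pow_abs (by decide), mul_pow]
        refine h3.trans (mul_le_mul_of_nonneg_right ?_ (by positivity))
        nlinarith [pow_nonneg hM0 2, pow_nonneg hM0 3, pow_nonneg hM0 4]
      exact (pow_le_pow_iff_left₀ (abs_nonneg _) (by positivity) (by norm_num)).1 h5
    · have h1 : (1 : ℝ) ≤ k / 2 ^ n := by
        rw [one_le_div (by positivity)]; exact_mod_cast hk
      have h2 : (1 : ℝ) ≤ (k + 1 : ℕ) / 2 ^ n := by
        rw [one_le_div (by positivity)]; exact_mod_cast hk.trans (Nat.le_succ k)
      simp only [Z, min_eq_right h1, min_eq_right h2, sub_self, abs_zero]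
      positivity
  -- The indicator replaces the path by `0` off the full-measure set `A`, so that the limit exists
  -- everywhere and is measurable.
  have hg (ω : Ω) : ∃ g : ℝ → ℝ, ContinuousOn g (Ici 0) ∧ ∀ t, 0 ≤ t →
      Tendsto (fun n ↦ A.indicator (fun ω ↦ dyadicStep (Z · ω) n t) ω) atTop (𝓝 (g t)) := by
    by_cases hω : ω ∈ A
    · simp only [indicator_of_mem hω]
      exact exists_continuousOn_tendsto_dyadicStep (hbound ω hω)
        (add_nonneg ENNReal.toReal_nonneg zero_le_one) (by norm_num) (by norm_num)
    · simp only [indicator_of_notMem hω]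
      exact ⟨0, continuousOn_const, fun t _ ↦ tendsto_const_nhds⟩
  choose g hgc hgt using hg
  refine ⟨fun t ω ↦ g ω (max t 0), fun t ↦ ?_, fun ω ↦ ?_, fun t ht ↦ ?_⟩
  · exact measurable_of_tendsto_metrizable
      (fun n ↦ (show Measurable fun ω ↦ dyadicStep (Z · ω) n (max t 0) from hZ _).indicator hA)
      (tendsto_pi_nhds.2 fun ω ↦ hgt ω _ (le_max_right _ _))
  · refine ((hgc ω).mono Icc_subset_Ici_self).congr fun t ht ↦ ?_
    simp only [max_eq_left ht.1]
  · simp only [max_eq_left ht.1]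
    have hstep (n : ℕ) : |(⌊2 ^ n * t⌋₊ / 2 ^ n - t : ℝ)| ≤ (1 / 2) ^ n := by
      have h1 := Nat.floor_le (show 0 ≤ 2 ^ n * t from mul_nonneg (by positivity) ht.1)
      have h2 := Nat.lt_floor_add_one (2 ^ n * t)
      have h3 : (⌊2 ^ n * t⌋₊ / 2 ^ n - t : ℝ) = (⌊2 ^ n * t⌋₊ - 2 ^ n * t) * (1 / 2) ^ n := by
        rw [div_pow, one_pow]; field_simp
      rw [h3, abs_mul, abs_of_nonneg (show (0 : ℝ) ≤ (1 / 2) ^ n by positivity)]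
      refine mul_le_of_le_one_left (by positivity) (abs_le.2 ⟨by linarith, by linarith⟩)
    have hmeas (n : ℕ) : Measurable fun ω ↦
        ENNReal.ofReal ((dyadicStep (Z · ω) n t - Z t ω) ^ 4) :=
      ENNReal.measurable_ofReal.comp (((hZ _).sub (hZ _)).pow_const 4)
    -- Summable fourth moments force the dyadic values to converge almost surely to `Z t`, which
    -- identifies the limit.
    have hint : ∫⁻ ω, ∑' n, ENNReal.ofReal ((dyadicStep (Z · ω) n t - Z t ω) ^ 4) ∂P ≠ ∞ := by
      rw [lintegral_tsum fun n ↦ (hmeas n).aemeasurable]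
      refine ne_top_of_le_ne_top (b := ∑' n : ℕ, ENNReal.ofReal (C * (1 / 4) ^ n)) ?_
        (ENNReal.tsum_le_tsum fun n ↦ ?_)
      · rw [← ENNReal.ofReal_tsum_of_nonneg (fun n ↦ by positivity)
          ((summable_geometric_of_lt_one (by norm_num) (by norm_num)).mul_left C)]
        exact ENNReal.ofReal_ne_top
      · refine (hZC _ _).trans (ENNReal.ofReal_le_ofReal (mul_le_mul_of_nonneg_left ?_ hC0))
        have h := pow_le_pow_left₀ (abs_nonneg _) (hstep n) 2
        rw [sq_abs, ← pow_mul, mul_comm n 2, pow_mul] at h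
        exact h.trans (le_of_eq (by norm_num))
    filter_upwards [hAae, ae_lt_top (Measurable.tsum hmeas) hint] with ω hω hlt
    have h1 := ENNReal.tendsto_atTop_zero_of_tsum_ne_top hlt.ne
    have h2 := hgt ω t ht.1
    simp only [indicator_of_mem hω] at h2
    have h3 : Tendsto (fun n ↦ ENNReal.ofReal ((dyadicStep (Z · ω) n t - Z t ω) ^ 4)) atTop
        (𝓝 (ENNReal.ofReal ((g ω t - Z t ω) ^ 4))) :=
      (ENNReal.continuous_ofReal.tendsto _).comp ((h2.sub_const _).pow 4)
    have h4 := tendsto_nhds_unique h1 h3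
    have h5 : (g ω t - Z t ω) ^ 4 = 0 :=
      le_antisymm (ENNReal.ofReal_eq_zero.1 h4.symm) (by positivity)
    have h6 : g ω t - Z t ω = 0 := by simpa using h5
    have h7 : Z t ω = Y t ω := by simp only [Z, min_eq_left ht.2]
    linarith

end Chaining

/-! ### Hilbert-space curves with exponential covariance -/

section ExponentialCovariance

variable {H : Type*} [NormedAddCommGroup H] [InnerProductSpace ℝ H]
  {lam : ℝ} {x : ℝ → H}

/-- The driving noise `x t - x 0 + λ ∫ x` of a curve `x` in a Hilbert space. -/
def noise (lam : ℝ) (x : ℝ → H) (t : ℝ) : H := x t - x 0 + lam • ∫ r in (0 : ℝ)..t, x r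

/-- The squared distance is `(1 - exp (-λ|s - t|)) / λ`, which tends to `0` as `s → t`. Continuity
is what makes the integral in `noise` manageable. -/
lemma continuous_of_inner_eq_exp
    (hx : ∀ s t, inner ℝ (x s) (x t) = Real.exp (-lam * |s - t|) / (2 * lam)) : Continuous x := by
  rw [continuous_iff_continuousAt]
  intro t
  rw [ContinuousAt, tendsto_iff_norm_sub_tendsto_zero]
  have h (s : ℝ) : ‖x s - x t‖ = √(2 * ((1 - Real.exp (-lam * |s - t|)) / (2 * lam))) := by
    rw [← Real.sqrt_sq (norm_nonneg (x s - x t)), norm_sub_sq_real, ← real_inner_self_eq_norm_sq,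
      ← real_inner_self_eq_norm_sq, hx, hx, hx]
    congr 1
    simp only [sub_self, abs_zero, mul_zero, Real.exp_zero]
    ring
  simp only [h]
  have : Continuous fun s ↦ √(2 * ((1 - Real.exp (-lam * |s - t|)) / (2 * lam))) := by fun_prop
  simpa using this.tendsto t

lemma integral_exp_neg_mul_sub (hlam : 0 < lam) (a b u : ℝ) :
    ∫ r in a..b, Real.exp (-lam * (r - u)) =
      (Real.exp (-lam * (a - u)) - Real.exp (-lam * (b - u))) / lam := by
  have hd (r : ℝ) : HasDerivAt (fun r ↦ -Real.exp (-lam * (r - u)) / lam)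
      (Real.exp (-lam * (r - u))) r := by
    have h := ((((hasDerivAt_id r).sub_const u).const_mul (-lam)).exp.neg).div_const lam
    refine h.congr_deriv ?_
    simp only [id]
    field_simp
  rw [intervalIntegral.integral_eq_sub_of_hasDerivAt (fun r _ ↦ hd r)
    (Continuous.intervalIntegrable (by fun_prop) _ _)]
  ring

variable [CompleteSpace H]

lemma inner_intervalIntegral (hc : Continuous x) (a b : ℝ) (y : H) :
    inner ℝ y (∫ r in a..b, x r) = ∫ r in a..b, inner ℝ y (x r) :=
  ((innerSL ℝ y).intervalIntegral_comp_comm (hc.intervalIntegrable a b)).symm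

variable (hlam : 0 < lam)
  (hx : ∀ s t, inner ℝ (x s) (x t) = Real.exp (-lam * |s - t|) / (2 * lam))
include hlam hx

lemma inner_integral_of_le {u s t : ℝ} (hus : u ≤ s) (hst : s ≤ t) :
    inner ℝ (x u) (∫ r in s..t, x r) =
      (Real.exp (-lam * (s - u)) - Real.exp (-lam * (t - u))) / (2 * lam ^ 2) := by
  rw [inner_intervalIntegral (continuous_of_inner_eq_exp hx)]
  have : ∀ r ∈ uIcc s t, inner ℝ (x u) (x r) = Real.exp (-lam * (r - u)) / (2 * lam) := by
    intro r hr
    rw [uIcc_of_le hst] at hr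
    rw [real_inner_comm, hx, abs_of_nonneg (by linarith [hr.1])]
  rw [intervalIntegral.integral_congr this, intervalIntegral.integral_div,
    integral_exp_neg_mul_sub hlam]
  field_simp

lemma inner_integral_of_ge {u s t : ℝ} (htu : t ≤ u) (hst : s ≤ t) :
    inner ℝ (x u) (∫ r in s..t, x r) =
      (Real.exp (-lam * (u - t)) - Real.exp (-lam * (u - s))) / (2 * lam ^ 2) := by
  rw [inner_intervalIntegral (continuous_of_inner_eq_exp hx)]
  have : ∀ r ∈ uIcc s t, inner ℝ (x u) (x r) = Real.exp (-lam * ((-r) - (-u))) / (2 * lam) := by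
    intro r hr
    rw [uIcc_of_le hst] at hr
    rw [hx, abs_of_nonneg (by linarith [hr.2])]
    ring_nf
  rw [intervalIntegral.integral_congr this, intervalIntegral.integral_div,
    intervalIntegral.integral_comp_neg (fun r ↦ Real.exp (-lam * (r - (-u)))),
    integral_exp_neg_mul_sub hlam]
  have e1 : -t - -u = u - t := by ring
  have e2 : -s - -u = u - s := by ring
  rw [e1, e2]
  field_simp

omit [CompleteSpace H] hlam in
lemma noise_sub {s t : ℝ} : noise lam x t - noise lam x s = x t - x s + lam • ∫ r in s..t, x r := by
  have hc := continuous_of_inner_eq_exp hx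
  rw [← intervalIntegral.integral_interval_sub_left (hc.intervalIntegrable 0 t)
    (hc.intervalIntegrable 0 s), noise, noise, smul_sub]
  abel

/-- The increments of the noise are orthogonal to the past. -/
lemma inner_noise_sub_of_le {u s t : ℝ} (hus : u ≤ s) (hst : s ≤ t) :
    inner ℝ (x u) (noise lam x t - noise lam x s) = 0 := by
  rw [noise_sub hx, inner_add_right, inner_sub_right, inner_smul_right,
    inner_integral_of_le hlam hx hus hst, real_inner_comm, hx, real_inner_comm (x s), hx,
    abs_of_nonneg (by linarith : 0 ≤ t - u), abs_of_nonneg (by linarith : 0 ≤ s - u)]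
  field_simp
  ring

lemma inner_zero_noise {t : ℝ} (ht : 0 ≤ t) : inner ℝ (x 0) (noise lam x t) = 0 := by
  have h := inner_noise_sub_of_le hlam hx le_rfl ht
  rwa [show noise lam x 0 = 0 by simp [noise], sub_zero] at h

lemma inner_self_noise {t : ℝ} (ht : 0 ≤ t) :
    inner ℝ (x t) (noise lam x t) = (1 - Real.exp (-lam * t)) / lam := by
  rw [noise, inner_add_right, inner_sub_right, inner_smul_right,
    inner_integral_of_ge hlam hx le_rfl ht, hx, hx]
  simp only [sub_self, abs_zero, mul_zero, Real.exp_zero, sub_zero, abs_of_nonneg ht]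
  field_simp
  ring

lemma inner_noise_of_le {s t : ℝ} (hs : 0 ≤ s) (hst : s ≤ t) :
    inner ℝ (x s) (noise lam x t) = (1 - Real.exp (-lam * s)) / lam := by
  rw [← sub_add_cancel (noise lam x t) (noise lam x s), inner_add_right,
    inner_noise_sub_of_le hlam hx le_rfl hst, zero_add, inner_self_noise hlam hx hs]

/-- The noise has the covariance of Brownian motion. -/
lemma inner_noise_noise {s t : ℝ} (hs : 0 ≤ s) (hst : s ≤ t) :
    inner ℝ (noise lam x s) (noise lam x t) = s := by
  have hc := continuous_of_inner_eq_exp hx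
  have h1 : ∀ r ∈ uIcc 0 s, inner ℝ (noise lam x t) (x r) =
      (1 - Real.exp (-lam * (r - 0))) / lam := by
    intro r hr
    rw [uIcc_of_le hs] at hr
    rw [real_inner_comm, inner_noise_of_le hlam hx hr.1 (hr.2.trans hst), sub_zero]
  rw [real_inner_comm]
  -- Only the noise at the earlier time is expanded: the products of `noise lam x t` with `x r` for
  -- `r ≤ s` are already known.
  conv_lhs => rw [noise.eq_def lam x s]
  rw [inner_add_right, inner_sub_right, inner_smul_right,
    inner_intervalIntegral hc, intervalIntegral.integral_congr h1, intervalIntegral.integral_div,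
    intervalIntegral.integral_sub (by simp) (Continuous.intervalIntegrable (by fun_prop) _ _),
    integral_exp_neg_mul_sub hlam, real_inner_comm, inner_noise_of_le hlam hx hs hst,
    real_inner_comm, inner_zero_noise hlam hx (hs.trans hst)]
  simp only [intervalIntegral.integral_const, sub_zero, smul_eq_mul, mul_one, mul_zero,
    Real.exp_zero]
  field_simp
  ring

end ExponentialCovariance

/-! ### Pathwise integrals as images of Bochner integrals -/

section PathIntegral

variable {H : Type*} [NormedAddCommGroup H] [InnerProductSpace ℝ H] [CompleteSpace H]
  {Ω : Type*} [MeasurableSpace Ω] {P : Measure Ω} [IsProbabilityMeasure P]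
  {G : H →ₗᵢ[ℝ] Lp ℝ 2 P}

/-- The pathwise integral of a continuous process in an isonormal space. -/
lemma intervalIntegral_ae_eq_isonormal {X : ℝ → Ω → ℝ} {x : ℝ → H} (hXm : ∀ t, Measurable (X t))
    (hXc : ∀ ω, Continuous (X · ω)) (hx : Continuous x) {t : ℝ} (ht : 0 ≤ t)
    (hX : ∀ s, 0 ≤ s → X s =ᵐ[P] G (x s)) :
    (fun ω ↦ ∫ s in (0 : ℝ)..t, X s ω) =ᵐ[P] G (∫ s in (0 : ℝ)..t, x s) := by
  have hmeas : Measurable (Function.uncurry X) :=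
    measurable_uncurry_of_continuous_of_measurable hXc hXm
  have hint (s : ℝ) (hs : 0 ≤ s) : Integrable (X s) P :=
    ((Lp.memLp (G (x s))).integrable (by norm_num)).congr (hX s hs).symm
  have hprod : Integrable (Function.uncurry X) ((volume.restrict (Ioc 0 t)).prod P) := by
    rw [integrable_prod_iff hmeas.aestronglyMeasurable]
    refine ⟨(ae_restrict_mem measurableSet_Ioc).mono fun s hs ↦ hint s hs.1.le, ?_⟩
    -- The `L¹` norm of `X s` is at most its `L²` norm `‖x s‖`, which is continuous in `s`.
    refine Integrable.mono' (g := fun s ↦ ‖x s‖) ?_ ?_ ?_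
    · exact (hx.norm.integrableOn_Icc).mono_set Ioc_subset_Icc_self
    · exact (hmeas.norm.stronglyMeasurable.integral_prod_right').aestronglyMeasurable
    · filter_upwards [ae_restrict_mem measurableSet_Ioc] with s hs
      rw [Real.norm_of_nonneg (by positivity), ← G.norm_map]
      refine le_trans (le_of_eq (integral_congr_ae ?_)) (integral_abs_le_norm_Lp (G (x s)))
      filter_upwards [hX s hs.1.le] with ω hω
      simp [Function.uncurry, hω]
  simp only [intervalIntegral.integral_of_le ht]
  -- Both sides are tested on an event `A`: Fubini handles the pathwise integral, while pairing with
  -- the indicator of `A` commutes with the Bochner integral.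
  refine Integrable.ae_eq_of_forall_setIntegral_eq _ _ hprod.integral_prod_right
    ((Lp.memLp _).integrable (by norm_num)) fun A hA hPA ↦ ?_
  have h1 : ∫ ω in A, G (∫ s in Ioc 0 t, x s) ω ∂P =
      ∫ s in Ioc 0 t, ∫ ω in A, X s ω ∂P := by
    rw [← L2.inner_indicatorConstLp_one hA hPA.ne]
    have h2 : inner ℝ (indicatorConstLp 2 hA hPA.ne (1 : ℝ)) (G (∫ s in Ioc 0 t, x s)) =
        ∫ s in Ioc 0 t, inner ℝ (indicatorConstLp 2 hA hPA.ne (1 : ℝ)) (G (x s)) :=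
      (((innerSL ℝ (indicatorConstLp 2 hA hPA.ne (1 : ℝ))).comp
        G.toContinuousLinearMap).integral_comp_comm
        (hx.integrableOn_Icc.mono_set Ioc_subset_Icc_self)).symm
    rw [h2]
    refine setIntegral_congr_fun measurableSet_Ioc fun s hs ↦ ?_
    rw [L2.inner_indicatorConstLp_one hA hPA.ne]
    exact integral_congr_ae (ae_restrict_of_ae (hX s hs.1.le).symm)
  rw [h1]
  refine (integral_integral_swap ?_).symm
  refine hprod.mono_measure ?_
  exact Measure.prod_mono le_rfl Measure.restrict_le_self

end PathIntegral

/-! ### Construction of stationary Ornstein–Uhlenbeck processes -/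

section OrnsteinUhlenbeck

variable {H : Type*} [NormedAddCommGroup H] [InnerProductSpace ℝ H] [CompleteSpace H]
  {Ω : Type*} [MeasurableSpace Ω] {P : Measure Ω} [IsProbabilityMeasure P]
  {G : H →ₗᵢ[ℝ] Lp ℝ 2 P} {lam : ℝ}

/-- A continuous process in an isonormal space with covariance `exp (-λ|t - s|) / (2λ)` is a
stationary Ornstein-Uhlenbeck process. -/
theorem IsIsonormal.isStationaryOrnsteinUhlenbeck (hG : IsIsonormal G) (hlam : 0 < lam)
    {X : ℝ≥0 → Ω → ℝ} {x : ℝ → H}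
    (hx : ∀ s t, inner ℝ (x s) (x t) = Real.exp (-lam * |s - t|) / (2 * lam))
    (hXm : ∀ t, Measurable (X t)) (hXc : ∀ ω, Continuous (X · ω))
    (hX : ∀ t : ℝ≥0, X t =ᵐ[P] G (x t)) : IsStationaryOrnsteinUhlenbeck lam X P := by
  have hI (t : ℝ≥0) : (fun ω ↦ ∫ s in (0 : ℝ)..t, X s.toNNReal ω) =ᵐ[P]
      G (∫ s in (0 : ℝ)..t, x s) := by
    refine intervalIntegral_ae_eq_isonormal (X := fun s ↦ X s.toNNReal) (fun s ↦ hXm _)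
      (fun ω ↦ (hXc ω).comp continuous_real_toNNReal) (continuous_of_inner_eq_exp hx) t.2
      fun s hs ↦ ?_
    simpa [Real.coe_toNNReal s hs] using hX s.toNNReal
  -- With this choice the integral equation is an identity; the content is that `W` is Brownian and
  -- independent of `X 0`.
  let W (t : ℝ≥0) (ω : Ω) : ℝ := X t ω - X 0 ω + lam * ∫ s in (0 : ℝ)..t, X s.toNNReal ω
  have hW (t : ℝ≥0) : W t =ᵐ[P] G (noise lam x t) := by
    rw [noise, map_add, map_sub, map_smul]
    filter_upwards [Lp.coeFn_add (G (x t) - G (x 0)) (lam • G (∫ s in (0 : ℝ)..t, x s)),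
      Lp.coeFn_sub (G (x t)) (G (x 0)), Lp.coeFn_smul lam (G (∫ s in (0 : ℝ)..t, x s)), hI t,
      hX t, hX 0] with ω h1 h2 h3 h4 h5 h6
    rw [h1, Pi.add_apply, h2, Pi.sub_apply, h3, Pi.smul_apply, ← h4, ← h5]
    simp only [NNReal.coe_zero] at h6
    rw [← h6]
    rfl
  have hWc (ω : Ω) : Continuous (W · ω) := by
    have h1 : Continuous fun s : ℝ ↦ X s.toNNReal ω := (hXc ω).comp continuous_real_toNNReal
    have h2 : Continuous fun t : ℝ≥0 ↦ ∫ s in (0 : ℝ)..t, X s.toNNReal ω :=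
      (intervalIntegral.continuous_primitive (fun a b ↦ h1.intervalIntegrable a b) 0).comp
        NNReal.continuous_coe
    exact ((hXc ω).sub continuous_const).add (continuous_const.mul h2)
  refine ⟨⟨W, ⟨?_, ae_of_all _ hWc⟩, ?_, ae_of_all _ fun ω ↦ ⟨hXc ω, fun t ↦ ?_⟩⟩, fun h ↦ ?_⟩
  · refine (hG.isGaussianProcess hW).isPreBrownianReal_of_covariance
      (fun t ↦ hG.integral_eq_zero (hW t)) fun s t hst ↦ ?_
    rw [hG.covariance_eq_inner (hW s) (hW t)]
    exact inner_noise_noise hlam hx s.2 hst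
  -- Adjoining `X 0` to `W` gives one Gaussian family, in which orthogonality means independence.
  · have h := (hG.isGaussianProcess (X := Sum.elim (fun _ : Unit ↦ X 0) W)
      (x := Sum.elim (fun _ ↦ x 0) (fun t : ℝ≥0 ↦ noise lam x t))
      (by rintro (_ | t)
          · simpa using hX 0
          · exact hW t)).indepFun_of_covariance_eq_zero (fun _ ↦ (hXm 0).aemeasurable)
      (fun t ↦ (hG.hasLaw (hW t)).aemeasurable) fun _ t ↦ by
        rw [hG.covariance_eq_inner (hX 0) (hW t)]
        exact inner_zero_noise hlam hx t.2
    have hφ : Measurable fun f : Unit → ℝ ↦ f () := by fun_prop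
    exact h.comp hφ measurable_id
  · simp only [W]
    ring
  · refine hG.identDistrib (fun t ↦ hX (t + h)) hX (fun t ↦ hXm _) hXm fun s t ↦ ?_
    rw [hx, hx]
    simp

/-- The `i`-th Brownian motion uses the white noise to the right of `i`. Different indices stay
disjoint only up to time `1`, whence the side condition. -/
lemma inner_indicator_Ioc (N : ℕ) (i j : Fin N) {u v : ℝ} (hu : 0 ≤ u) (hv : 0 ≤ v)
    (h : i = j ∨ u ≤ 1 ∧ v ≤ 1) :
    inner ℝ (indicatorConstLp 2 (μ := volume) (s := Ioc (i : ℝ) (i + u)) measurableSet_Ioc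
        (by simp) (1 : ℝ))
      (indicatorConstLp 2 (μ := volume) (s := Ioc (j : ℝ) (j + v)) measurableSet_Ioc (by simp)
        (1 : ℝ)) = if i = j then min u v else 0 := by
  rw [L2.real_inner_indicatorConstLp_one_indicatorConstLp_one measurableSet_Ioc measurableSet_Ioc
    measure_Ioc_lt_top.ne measure_Ioc_lt_top.ne, Ioc_inter_Ioc]
  split_ifs with hij
  · subst hij
    rw [max_self, min_add_add_left, Real.volume_real_Ioc_of_le (by simp [hu, hv])]
    ring
  · obtain ⟨hu1, hv1⟩ := h.resolve_left hij
    rw [Ioc_eq_empty, measureReal_empty]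
    rw [not_lt]
    rcases lt_or_gt_of_ne hij with h | h
    · have : ((i : ℕ) : ℝ) + 1 ≤ (j : ℕ) := by exact_mod_cast h
      exact (min_le_left _ _).trans (le_trans (by linarith) (le_max_right _ _))
    · have : ((j : ℕ) : ℝ) + 1 ≤ (i : ℕ) := by exact_mod_cast h
      exact (min_le_right _ _).trans (le_trans (by linarith) (le_max_left _ _))

omit [CompleteSpace H] [IsProbabilityMeasure P] in
lemma IsIsonormal.lintegral_sub_pow_four (hG : IsIsonormal G) (x y : H) :
    ∫⁻ ω, ENNReal.ofReal ((G y ω - G x ω) ^ 4) ∂P =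
      ENNReal.ofReal ((∫ x, x ^ 4 ∂gaussianReal 0 1) * (‖y - x‖ ^ 2) ^ 2) := by
  have h : (fun ω ↦ G y ω - G x ω) =ᵐ[P] G (y - x) := by
    rw [map_sub]
    exact (Lp.coeFn_sub _ _).symm
  rw [(hG.hasLaw h).lintegral_comp (f := fun z ↦ ENNReal.ofReal (z ^ 4)) (by fun_prop),
    lintegral_pow_four_gaussianReal]
  simp

/-- Independent Brownian motions on `[0, 1]` with continuous paths, in a common isonormal space. -/
theorem exists_brownian_unitInterval (N : ℕ) :
    ∃ (Ω : Type) (_ : MeasurableSpace Ω) (P : Measure Ω) (_ : IsProbabilityMeasure P)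
      (G : Lp ℝ 2 (volume : Measure ℝ) →ₗᵢ[ℝ] Lp ℝ 2 P)
      (B : Fin N → ℝ → Ω → ℝ) (b : Fin N → ℝ → Lp ℝ 2 (volume : Measure ℝ)), IsIsonormal G ∧
      (∀ i t, Measurable (B i t)) ∧ (∀ i ω, ContinuousOn (B i · ω) (Icc 0 1)) ∧
      (∀ i, ∀ t ∈ Icc (0 : ℝ) 1, B i t =ᵐ[P] G (b i t)) ∧
      ∀ i j u v, 0 ≤ u → 0 ≤ v → (i = j ∨ u ≤ 1 ∧ v ≤ 1) →
        inner ℝ (b i u) (b j v) = if i = j then min u v else 0 := by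
  obtain ⟨Ω, mΩ, P, hP, G, hG⟩ := exists_isonormal (Lp ℝ 2 (volume : Measure ℝ))
  let b (i : Fin N) (u : ℝ) : Lp ℝ 2 (volume : Measure ℝ) :=
    indicatorConstLp 2 (μ := volume) (s := Ioc (i : ℝ) (i + u)) measurableSet_Ioc (by simp) (1 : ℝ)
  have hb (i j : Fin N) (u v : ℝ) (hu : 0 ≤ u) (hv : 0 ≤ v) (h : i = j ∨ u ≤ 1 ∧ v ≤ 1) :
      inner ℝ (b i u) (b j v) = if i = j then min u v else 0 := inner_indicator_Ioc N i j hu hv h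
  have hsub (i : Fin N) (s t : ℝ) : ‖b i (max t 0) - b i (max s 0)‖ ^ 2 ≤ |t - s| := by
    rw [norm_sub_sq_real, ← real_inner_self_eq_norm_sq, ← real_inner_self_eq_norm_sq,
      hb _ _ _ _ (le_max_right _ _) (le_max_right _ _) (.inl rfl),
      hb _ _ _ _ (le_max_right _ _) (le_max_right _ _) (.inl rfl),
      hb _ _ _ _ (le_max_right _ _) (le_max_right _ _) (.inl rfl)]
    simp only [if_true, min_self]
    refine le_trans ?_ (show |max t 0 - max s 0| ≤ |t - s| by
      simpa using abs_max_sub_max_le_max t 0 s 0)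
    rcases le_total (max t 0) (max s 0) with h | h
    · rw [min_eq_left h, abs_of_nonpos (by linarith)]
      linarith
    · rw [min_eq_right h, abs_of_nonneg (by linarith)]
      linarith
  have hC : 0 ≤ ∫ x, x ^ 4 ∂gaussianReal 0 1 := integral_nonneg fun x ↦ by positivity
  have hex (i : Fin N) := exists_continuous_modification (P := P)
    (Y := fun t ↦ G (b i (max t 0))) (fun t ↦ (Lp.stronglyMeasurable _).measurable) hC
    (fun s t ↦ by
      rw [IsIsonormal.lintegral_sub_pow_four hG]
      refine ENNReal.ofReal_le_ofReal (mul_le_mul_of_nonneg_left ?_ hC)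
      rw [← sq_abs (t - s)]
      exact pow_le_pow_left₀ (by positivity) (hsub i s t) 2)
  choose B hBm hBc hB using hex
  exact ⟨Ω, mΩ, P, hP, G, B, b, hG, hBm, hBc,
    fun i t ht ↦ by simpa [max_eq_left ht.1] using hB i t ht, hb⟩

/-- Existence of independent stationary Ornstein-Uhlenbeck processes, jointly Gaussian. -/
theorem exists_stationaryOrnsteinUhlenbeck (N : ℕ) (hlam : 0 < lam) :
    ∃ (Ω : Type) (_ : MeasurableSpace Ω) (P : Measure Ω) (X : Fin N → ℝ≥0 → Ω → ℝ),
      IsProbabilityMeasure P ∧ (∀ i t, Measurable (X i t)) ∧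
      IsGaussianProcess (fun p : Fin N × ℝ≥0 ↦ X p.1 p.2) P ∧
      (∀ i t, ∫ ω, X i t ω ∂P = 0) ∧
      (∀ i j s t, cov[X i s, X j t; P] =
        if i = j then Real.exp (-lam * |(s : ℝ) - t|) / (2 * lam) else 0) ∧
      iIndepFun (fun i ω (t : ℝ≥0) ↦ X i t ω) P ∧
      ∀ i, IsStationaryOrnsteinUhlenbeck lam (X i) P := by
  obtain ⟨Ω, mΩ, P, hP, G, B, b, hG, hBm, hBc, hB, hb⟩ := exists_brownian_unitInterval N
  -- Decreasing time change: for `t ≥ 0` the Brownian time lies in `(0, 1]`, so the unit interval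
  -- suffices.
  let X (i : Fin N) (t : ℝ≥0) (ω : Ω) : ℝ :=
    Real.exp (lam * t) / √(2 * lam) * B i (Real.exp (-2 * lam * t)) ω
  let x (i : Fin N) (t : ℝ) : Lp ℝ 2 (volume : Measure ℝ) :=
    (Real.exp (lam * t) / √(2 * lam)) • b i (Real.exp (-2 * lam * t))
  have hle (t : ℝ) (ht : 0 ≤ t) : Real.exp (-2 * lam * t) ≤ 1 := by
    rw [Real.exp_le_one_iff]
    have := mul_nonneg hlam.le ht
    linarith
  -- Negative times are needed for a single index, since the curve must have exponential covariance
  -- on all of `ℝ`; orthogonality of distinct components is used at nonnegative times only.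
  have hinner (i j : Fin N) (s t : ℝ) (h : i = j ∨ 0 ≤ s ∧ 0 ≤ t) :
      inner ℝ (x i s) (x j t) = if i = j then Real.exp (-lam * |s - t|) / (2 * lam) else 0 := by
    simp only [x]
    rw [inner_smul_left, inner_smul_right, hb _ _ _ _ (Real.exp_pos _).le (Real.exp_pos _).le
      (h.imp id fun h ↦ ⟨hle _ h.1, hle _ h.2⟩)]
    split_ifs with hij
    · have h2 : √(2 * lam) * √(2 * lam) = 2 * lam := Real.mul_self_sqrt (by positivity)
      have key : Real.exp (lam * s) * (Real.exp (lam * t) *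
          min (Real.exp (-2 * lam * s)) (Real.exp (-2 * lam * t))) =
          Real.exp (-lam * |s - t|) := by
        rcases le_total s t with hst | hst
        · rw [min_eq_right (Real.exp_le_exp.2 (by nlinarith)), abs_of_nonpos (by linarith),
            ← Real.exp_add, ← Real.exp_add]
          ring_nf
        · rw [min_eq_left (Real.exp_le_exp.2 (by nlinarith)), abs_of_nonneg (by linarith),
            ← Real.exp_add, ← Real.exp_add]
          ring_nf
      rw [← key]
      simp only [conj_trivial]
      generalize √(2 * lam) = q at h2 ⊢
      have hq : q ≠ 0 := by rintro rfl; linarith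
      rw [← h2]
      field_simp
    · simp
  have hXm (i : Fin N) (t : ℝ≥0) : Measurable (X i t) := (hBm _ _).const_mul _
  have hXc (i : Fin N) (ω : Ω) : Continuous (X i · ω) := by
    have h1 : Continuous fun t : ℝ≥0 ↦ B i (Real.exp (-2 * lam * t)) ω :=
      (hBc i ω).comp_continuous (by fun_prop) fun t ↦ ⟨(Real.exp_pos _).le, hle t t.2⟩
    exact Continuous.mul (by fun_prop) h1
  have hX (i : Fin N) (t : ℝ≥0) : X i t =ᵐ[P] G (x i t) := by
    simp only [x]
    rw [map_smul]
    filter_upwards [hB i (Real.exp (-2 * lam * t)) ⟨(Real.exp_pos _).le, hle t t.2⟩,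
      Lp.coeFn_smul (Real.exp (lam * t) / √(2 * lam)) (G (b i (Real.exp (-2 * lam * t))))]
      with ω h1 h2
    rw [h2, Pi.smul_apply, ← h1]
    rfl
  have hcov (i j : Fin N) (s t : ℝ≥0) : cov[X i s, X j t; P] =
      if i = j then Real.exp (-lam * |(s : ℝ) - t|) / (2 * lam) else 0 := by
    rw [hG.covariance_eq_inner (hX i s) (hX j t), hinner i j s t (.inr ⟨s.2, t.2⟩)]
  refine ⟨Ω, mΩ, P, X, hP, hXm, hG.isGaussianProcess fun p ↦ hX p.1 p.2,
    fun i t ↦ hG.integral_eq_zero (hX i t), hcov, ?_, fun i ↦ ?_⟩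
  · refine IsGaussianProcess.iIndepFun_of_covariance_eq_zero (S := fun _ : Fin N ↦ ℝ≥0)
      (hG.isGaussianProcess fun p ↦ hX p.1 p.2) (fun i t ↦ (hXm i t).aemeasurable)
      fun i j hij s t ↦ ?_
    rw [hcov, if_neg hij]
  · exact hG.isStationaryOrnsteinUhlenbeck hlam (fun s t ↦ by rw [hinner i i s t (.inl rfl), if_pos rfl])
      (hXm i) (hXc i) (hX i)

end OrnsteinUhlenbeck

/-! ### Isotropic Gaussian measures on `ℝ^N` -/

section IsotropicGaussian

/-- The centered Gaussian measure on `ℝ^N` with covariance matrix `v I`. -/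
def isoGaussian (N : ℕ) (v : ℝ≥0) : Measure (EuclideanSpace ℝ (Fin N)) :=
  (Measure.pi fun _ : Fin N ↦ gaussianReal 0 v).map (WithLp.toLp 2)

instance (N : ℕ) (v : ℝ≥0) : IsProbabilityMeasure (isoGaussian N v) :=
  Measure.isProbabilityMeasure_map (by fun_prop)

/-- The density of the centered Gaussian measure on `ℝ^N` with covariance matrix `v I`. -/
def isoDensity (N : ℕ) (v : ℝ) (z : EuclideanSpace ℝ (Fin N)) : ℝ :=
  (2 * Real.pi * v) ^ (-(N : ℝ) / 2) * Real.exp (-‖z‖ ^ 2 / (2 * v))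

lemma measurable_isoDensity (N : ℕ) (v : ℝ) : Measurable (isoDensity N v) := by
  unfold isoDensity
  fun_prop

lemma isoDensity_nonneg (N : ℕ) {v : ℝ} (hv : 0 ≤ v) (z : EuclideanSpace ℝ (Fin N)) :
    0 ≤ isoDensity N v z := by
  unfold isoDensity
  positivity

lemma pi_gaussianReal_eq_withDensity (N : ℕ) {v : ℝ≥0} (hv : v ≠ 0) :
    (Measure.pi fun _ : Fin N ↦ gaussianReal 0 v) =
      volume.withDensity fun x ↦ ENNReal.ofReal (∏ i, gaussianPDFReal 0 v (x i)) := by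
  refine Measure.pi_eq fun s hs ↦ ?_
  have hint (i : Fin N) : Integrable ((s i).indicator (gaussianPDFReal 0 v)) volume :=
    (integrable_gaussianPDFReal 0 v).indicator (hs i)
  have hnn (i : Fin N) (x : ℝ) : 0 ≤ (s i).indicator (gaussianPDFReal 0 v) x :=
    indicator_nonneg (fun x _ ↦ gaussianPDFReal_nonneg _ _ _) x
  have hprod (x : Fin N → ℝ) : (univ.pi s).indicator
      (fun x ↦ ENNReal.ofReal (∏ i, gaussianPDFReal 0 v (x i))) x =
      ENNReal.ofReal (∏ i, (s i).indicator (gaussianPDFReal 0 v) (x i)) := by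
    by_cases hx : x ∈ univ.pi s
    · rw [indicator_of_mem hx]
      congr 1
      exact Finset.prod_congr rfl fun i _ ↦ (indicator_of_mem (hx i (mem_univ i)) _).symm
    · rw [indicator_of_notMem hx]
      obtain ⟨i, hi⟩ : ∃ i, x i ∉ s i := by simpa [mem_univ_pi] using hx
      rw [Finset.prod_eq_zero (Finset.mem_univ i) (indicator_of_notMem hi _), ENNReal.ofReal_zero]
  rw [withDensity_apply _ (MeasurableSet.univ_pi hs), ← lintegral_indicator (MeasurableSet.univ_pi hs)]
  simp_rw [hprod]
  have hI : Integrable (fun x : Fin N → ℝ ↦ ∏ i, (s i).indicator (gaussianPDFReal 0 v) (x i))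
      volume := Integrable.fintype_prod hint
  rw [← ofReal_integral_eq_lintegral_ofReal hI
    (ae_of_all _ fun x ↦ Finset.prod_nonneg fun i _ ↦ hnn i _),
    integral_fintype_prod_volume_eq_prod (fun i x ↦ (s i).indicator (gaussianPDFReal 0 v) x),
    ENNReal.ofReal_prod_of_nonneg fun i _ ↦ integral_nonneg (hnn i)]
  refine Finset.prod_congr rfl fun i _ ↦ ?_
  rw [integral_indicator (hs i), gaussianReal_apply_eq_integral 0 hv]

lemma prod_gaussianPDFReal (N : ℕ) {v : ℝ≥0} (z : EuclideanSpace ℝ (Fin N)) :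
    ∏ i, gaussianPDFReal 0 v (z i) = isoDensity N v z := by
  simp only [gaussianPDFReal, sub_zero, isoDensity]
  rw [Finset.prod_mul_distrib, Finset.prod_const, ← Real.exp_sum, ← Finset.sum_div,
    Finset.sum_neg_distrib, EuclideanSpace.real_norm_sq_eq, Finset.card_univ, Fintype.card_fin]
  congr 1
  have h : (0 : ℝ) ≤ 2 * Real.pi * v := by positivity
  rw [Real.sqrt_eq_rpow, ← Real.rpow_neg h, ← Real.rpow_mul_natCast h]
  congr 1
  ring

lemma isoGaussian_eq_withDensity (N : ℕ) {v : ℝ≥0} (hv : v ≠ 0) :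
    isoGaussian N v = volume.withDensity fun z ↦ ENNReal.ofReal (isoDensity N v z) := by
  ext s hs
  have hm : Measurable (WithLp.toLp 2 : (Fin N → ℝ) → EuclideanSpace ℝ (Fin N)) := by fun_prop
  rw [isoGaussian, Measure.map_apply hm hs, pi_gaussianReal_eq_withDensity N hv,
    withDensity_apply _ (hm hs), withDensity_apply _ hs,
    ← (PiLp.volume_preserving_toLp (Fin N)).setLIntegral_comp_preimage hs
      (measurable_isoDensity N v).ennreal_ofReal]
  refine lintegral_congr fun x ↦ ?_
  rw [← prod_gaussianPDFReal]

lemma isoGaussian_real_apply (N : ℕ) {v : ℝ≥0} (hv : v ≠ 0)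
    {E : Set (EuclideanSpace ℝ (Fin N))} (hE : MeasurableSet E) :
    (isoGaussian N v).real E = ∫ z in E, isoDensity N v z := by
  rw [measureReal_def, isoGaussian_eq_withDensity N hv, withDensity_apply _ hE,
    integral_eq_lintegral_of_nonneg_ae (ae_of_all _ fun z ↦ isoDensity_nonneg N v.coe_nonneg z)
      (measurable_isoDensity N v).aestronglyMeasurable]

/-- A centered jointly Gaussian vector with uncorrelated components of variance `v` has law
`isoGaussian N v`. -/
lemma hasLaw_isoGaussian {Ω : Type*} [MeasurableSpace Ω] {P : Measure Ω} {N : ℕ}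
    {U : Ω → EuclideanSpace ℝ (Fin N)} {v : ℝ≥0} (hU : HasGaussianLaw (fun ω i ↦ U ω i) P)
    (hmean : ∀ i, ∫ ω, U ω i ∂P = 0)
    (hcov : ∀ i j, cov[fun ω ↦ U ω i, fun ω ↦ U ω j; P] = if i = j then (v : ℝ) else 0) :
    HasLaw U (isoGaussian N v) P := by
  have hi (i : Fin N) : HasLaw (fun ω ↦ U ω i) (gaussianReal 0 v) P := by
    have h := hU.eval (X := fun i ω ↦ U ω i) i
    refine ⟨h.aemeasurable, ?_⟩
    have hv := hcov i i
    rw [if_pos rfl, covariance_self h.aemeasurable] at hv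
    rw [h.map_eq_gaussianReal, hmean, hv, Real.toNNReal_coe]
  have hind : iIndepFun (fun i ω ↦ U ω i) P :=
    hU.iIndepFun_of_covariance_eq_zero (X := fun i ω ↦ U ω i) fun i j hij ↦ by
      rw [hcov, if_neg hij]
  have h := hind.hasLaw_pi hi
  have h2 : HasLaw (WithLp.toLp 2 : (Fin N → ℝ) → EuclideanSpace ℝ (Fin N)) (isoGaussian N v)
      (Measure.pi fun _ : Fin N ↦ gaussianReal 0 v) := ⟨by fun_prop, rfl⟩
  exact h2.comp h

end IsotropicGaussian

/-! ### Gaussian identities for Mehler's kernel -/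

section MehlerBridge

variable {N : ℕ} {lam : ℝ}

lemma sinh_sub_eq (lam r s t : ℝ) : Real.sinh (lam * (t - s)) =
    Real.sinh (lam * (t - r)) * Real.cosh (lam * (r - s)) +
      Real.cosh (lam * (t - r)) * Real.sinh (lam * (r - s)) := by
  rw [← Real.sinh_add]
  ring_nf

lemma cosh_sub_eq (lam r s t : ℝ) : Real.cosh (lam * (t - s)) =
    Real.cosh (lam * (t - r)) * Real.cosh (lam * (r - s)) +
      Real.sinh (lam * (t - r)) * Real.sinh (lam * (r - s)) := by
  rw [← Real.cosh_add]
  ring_nf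

/-- The bridge density of Mehler's kernel is a Gaussian density. -/
lemma bernsteinDensity_mehlerKernel (hlam : 0 < lam) {r s t : ℝ} (hsr : s < r) (hrt : r < t)
    (x y z : EuclideanSpace ℝ (Fin N)) :
    bernsteinDensity (mehlerKernel N lam) x t z r y s =
      isoDensity N (Real.sinh (lam * (r - s)) * Real.sinh (lam * (t - r)) /
          (lam * Real.sinh (lam * (t - s))))
        (z - ((Real.sinh (lam * (r - s)) / Real.sinh (lam * (t - s))) • x +
          (Real.sinh (lam * (t - r)) / Real.sinh (lam * (t - s))) • y)) := by
  have hA : 0 < Real.sinh (lam * (r - s)) := Real.sinh_pos_iff.2 (mul_pos hlam (by linarith))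
  have hB : 0 < Real.sinh (lam * (t - r)) := Real.sinh_pos_iff.2 (mul_pos hlam (by linarith))
  have hC : 0 < Real.sinh (lam * (t - s)) := Real.sinh_pos_iff.2 (mul_pos hlam (by linarith))
  have h1 := sinh_sub_eq lam r s t
  have h2 := cosh_sub_eq lam r s t
  have h3 := Real.cosh_sq (lam * (r - s))
  have h4 := Real.cosh_sq (lam * (t - r))
  unfold bernsteinDensity mehlerKernel isoDensity
  generalize Real.sinh (lam * (r - s)) = A at *
  generalize Real.sinh (lam * (t - r)) = B at *
  generalize Real.sinh (lam * (t - s)) = C at *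
  generalize Real.cosh (lam * (r - s)) = a at *
  generalize Real.cosh (lam * (t - r)) = b at *
  generalize Real.cosh (lam * (t - s)) = c at *
  have hpi := Real.pi_pos
  have hpre : (lam / (2 * Real.pi * B)) ^ ((N : ℝ) / 2) * (lam / (2 * Real.pi * A)) ^ ((N : ℝ) / 2) /
      (lam / (2 * Real.pi * C)) ^ ((N : ℝ) / 2) =
      (2 * Real.pi * (A * B / (lam * C))) ^ (-(N : ℝ) / 2) := by
    rw [← Real.mul_rpow (by positivity) (by positivity), ← Real.div_rpow (by positivity) (by positivity),
      neg_div, Real.rpow_neg (by positivity), ← Real.inv_rpow (by positivity)]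
    congr 1
    field_simp
  rw [← hpre]
  have hexp : ∀ p q u : ℝ, Real.exp p * Real.exp q / Real.exp u = Real.exp (p + q - u) := fun p q u ↦ by
    rw [Real.exp_sub, Real.exp_add]
  rw [show ∀ p1 p2 p3 e1 e2 e3 : ℝ, p1 * e1 * (p2 * e2) / (p3 * e3) =
    (p1 * p2 / p3) * (e1 * e2 / e3) from fun _ _ _ _ _ _ ↦ by ring, hexp]
  congr 2
  -- These are the subtraction formulas for `sinh` at `r - s = (t - s) - (t - r)` and at `t - r = (t
  -- - s) - (r - s)`. They match the coefficients of `‖x‖ ^ 2` and `‖y‖ ^ 2` in the completed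
  -- square.
  have hx1 : b * C - c * B = A := by rw [h1, h2]; linear_combination A * h4
  have hx2 : a * C - c * A = B := by rw [h1, h2]; linear_combination B * h3
  rw [norm_sub_sq_real, norm_add_sq_real, inner_add_right, inner_smul_right, inner_smul_right,
    inner_smul_left, inner_smul_right, norm_smul, norm_smul, mul_pow, mul_pow, Real.norm_eq_abs,
    Real.norm_eq_abs, sq_abs, sq_abs, real_inner_comm x z, conj_trivial]
  generalize inner ℝ x z = xz
  generalize inner ℝ z y = zy
  generalize inner ℝ x y = xy
  generalize ‖x‖ ^ 2 = xx
  generalize ‖y‖ ^ 2 = yy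
  generalize ‖z‖ ^ 2 = zz
  field_simp
  linear_combination (-A * xx) * hx1 + (-B * yy) * hx2 + C * zz * h1

/-- The joint density of the endpoints of the stationary process. -/
lemma groundState_mul_mehlerKernel (hlam : 0 < lam) {T : ℝ} (hT : 0 < T)
    (x y : EuclideanSpace ℝ (Fin N)) :
    groundStateDensity N lam T x * groundStateDensity N lam T y * mehlerKernel N lam x T y =
      isoDensity N (1 / (2 * lam)) x *
        isoDensity N ((1 - Real.exp (-lam * T) ^ 2) / (2 * lam)) (y - Real.exp (-lam * T) • x) := by
  have hS : 0 < Real.sinh (lam * T) := Real.sinh_pos_iff.2 (by positivity)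
  have hpi := Real.pi_pos
  -- In terms of `e` the hyperbolic functions are rational, so the comparison of prefactors and
  -- exponents is algebraic.
  set e := Real.exp (-lam * T) with he
  have he0 : 0 < e := Real.exp_pos _
  have hp : Real.exp (lam * T) = e⁻¹ := by rw [he, ← Real.exp_neg]; ring_nf
  have hs : Real.sinh (lam * T) = (e⁻¹ - e) / 2 := by
    rw [Real.sinh_eq, hp, he]; ring_nf
  have hc : Real.cosh (lam * T) = (e⁻¹ + e) / 2 := by
    rw [Real.cosh_eq, hp, he]; ring_nf
  have he1 : 0 < 1 - e ^ 2 := by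
    rw [hs] at hS
    have : 0 < e⁻¹ - e := by linarith
    have h2 := mul_pos he0 this
    rw [mul_sub, mul_inv_cancel₀ he0.ne'] at h2
    nlinarith
  unfold groundStateDensity mehlerKernel isoDensity
  rw [hp, hs, hc]
  have h0 : 0 < e⁻¹ - e := by rw [hs] at hS; linarith
  have hpre : (lam * e⁻¹ / Real.pi) ^ ((N : ℝ) / 4) * (lam * e⁻¹ / Real.pi) ^ ((N : ℝ) / 4) *
      (lam / (2 * Real.pi * ((e⁻¹ - e) / 2))) ^ ((N : ℝ) / 2) =
      (2 * Real.pi * (1 / (2 * lam))) ^ (-(N : ℝ) / 2) *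
      (2 * Real.pi * ((1 - e ^ 2) / (2 * lam))) ^ (-(N : ℝ) / 2) := by
    rw [← Real.rpow_add (by positivity), show (N : ℝ) / 4 + N / 4 = N / 2 by ring,
      ← Real.mul_rpow (by positivity) (by positivity), ← Real.mul_rpow (by positivity) (by positivity),
      neg_div, Real.rpow_neg (by positivity), ← Real.inv_rpow (by positivity)]
    congr 1
    field_simp
  rw [show ∀ p1 p2 p3 e1 e2 e3 : ℝ, p1 * e1 * (p2 * e2) * (p3 * e3) =
    (p1 * p2 * p3) * (e1 * e2 * e3) from fun _ _ _ _ _ _ ↦ by ring]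
  conv_rhs => rw [mul_mul_mul_comm]
  rw [hpre, ← Real.exp_add, ← Real.exp_add, ← Real.exp_add]
  congr 2
  rw [norm_sub_sq_real, inner_smul_right, norm_smul, mul_pow, Real.norm_eq_abs, sq_abs,
    real_inner_comm x y]
  generalize inner ℝ x y = xy
  generalize ‖x‖ ^ 2 = xx
  generalize ‖y‖ ^ 2 = yy
  have h5 : e⁻¹ - e = (1 - e ^ 2) / e := by field_simp
  have h6 : e⁻¹ + e = (1 + e ^ 2) / e := by field_simp
  rw [h5, h6]
  field_simp
  ring

end MehlerBridge

/-! ### Conditional laws that are translates of a fixed law -/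

section Conditioning

variable {Ω 𝓧 E : Type*} [MeasurableSpace Ω] {P : Measure Ω} [IsProbabilityMeasure P]
  [MeasurableSpace 𝓧] [MeasurableSpace E] [StandardBorelSpace E] [Nonempty E]

/-- Conditioning a function of `X` and of an independent variable `U` on `X`. -/
lemma condExp_comp_ae_eq_of_indepFun {X : Ω → 𝓧} {U : Ω → E} (hX : Measurable X)
    (hU : Measurable U) (h : IndepFun X U P) {f : 𝓧 × E → ℝ} (hf : Measurable f)
    (hfb : ∃ C, ∀ x, |f x| ≤ C) :
    P[fun ω ↦ f (X ω, U ω) | MeasurableSpace.comap X inferInstance] =ᵐ[P]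
      fun ω ↦ ∫ u, f (X ω, u) ∂P.map U := by
  have := Measure.isProbabilityMeasure_map (μ := P) hU.aemeasurable
  obtain ⟨C, hC⟩ := hfb
  have h1 := condExp_prod_ae_eq_integral_condDistrib (μ := P) hX hU.aemeasurable
    hf.stronglyMeasurable (Integrable.of_bound
      (hf.comp (hX.prodMk hU)).aestronglyMeasurable C (ae_of_all _ fun ω ↦ hC _))
  have h2 : condDistrib U X P =ᵐ[P.map X] Kernel.const 𝓧 (P.map U) := by
    refine condDistrib_ae_eq_of_measure_eq_compProd X hU.aemeasurable ?_
    rw [Measure.compProd_const]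
    exact (indepFun_iff_map_prod_eq_prod_map_map hX.aemeasurable hU.aemeasurable).1 h
  filter_upwards [h1, ae_of_ae_map hX.aemeasurable h2] with ω h3 h4
  rw [h3, h4]
  rfl

variable [AddGroup E] [MeasurableAdd₂ E] [MeasurableSub₂ E]

/-- If the conditional law of `Y` given `X` is a translate by `v X` of a fixed law `γ`, then
`Y - v X` has law `γ` and is independent of `X`. -/
lemma indepFun_sub_of_condExp {X : Ω → 𝓧} {Y : Ω → E} (hX : Measurable X) (hY : Measurable Y)
    {v : 𝓧 → E} (hv : Measurable v) {γ : Measure E} [IsProbabilityMeasure γ]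
    (h : ∀ S, MeasurableSet S →
      P[(Y ⁻¹' S).indicator (fun _ ↦ (1 : ℝ)) | MeasurableSpace.comap X inferInstance] =ᵐ[P]
        fun ω ↦ γ.real ((fun u ↦ u + v (X ω)) ⁻¹' S)) :
    IndepFun X (fun ω ↦ Y ω - v (X ω)) P ∧ P.map (fun ω ↦ Y ω - v (X ω)) = γ := by
  have hs : Measurable fun p : 𝓧 × E ↦ p.2 + v p.1 := by fun_prop
  have hd : Measurable fun p : 𝓧 × E ↦ (p.1, p.2 - v p.1) := by fun_prop
  -- The kernel sends `x` to the translate of `γ` by `v x`; building it as an image kernel gives its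
  -- measurability.
  let κ : Kernel 𝓧 E := (Kernel.id ×ₖ Kernel.const 𝓧 γ).map fun p ↦ p.2 + v p.1
  have hκ' : IsMarkovKernel κ := Kernel.IsMarkovKernel.map _ hs
  have hκ (x : 𝓧) : κ x = γ.map fun u ↦ u + v x := by
    simp only [κ]
    rw [Kernel.map_apply _ hs, Kernel.prod_apply, Kernel.id_apply, Kernel.const_apply,
      Measure.dirac_prod, Measure.map_map hs (by fun_prop)]
    rfl
  have hjoint : P.map (fun ω ↦ (X ω, Y ω)) = P.map X ⊗ₘ κ := by
    refine Measure.ext_prod fun {A S} hA hS ↦ ?_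
    rw [Measure.compProd_apply_prod hA hS, setLIntegral_map hA (κ.measurable_coe hS) hX,
      Measure.map_apply (hX.prodMk hY) (hA.prod hS), mk_preimage_prod,
      ← setLIntegral_preimage_condDistrib hX hY.aemeasurable hS hA]
    refine lintegral_congr_ae (ae_restrict_of_ae ?_)
    filter_upwards [condDistrib_ae_eq_condExp (μ := P) hX hY hS, h S hS] with ω h1 h2
    rw [h2] at h1
    rw [hκ, Measure.map_apply (by fun_prop) hS]
    simpa [measureReal_def, ENNReal.toReal_eq_toReal_iff'] using h1
  -- Shearing by `-v` undoes the translation fibrewise and leaves a product measure.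
  have hmap : P.map (fun ω ↦ (X ω, Y ω - v (X ω))) = (P.map X).prod γ := by
    have e : (fun ω ↦ (X ω, Y ω - v (X ω))) = (fun p : 𝓧 × E ↦ (p.1, p.2 - v p.1)) ∘
      fun ω ↦ (X ω, Y ω) := rfl
    rw [e, ← Measure.map_map hd (hX.prodMk hY), hjoint]
    ext S hS
    rw [Measure.map_apply hd hS, Measure.compProd_apply (hd hS), Measure.prod_apply hS]
    refine lintegral_congr fun x ↦ ?_
    rw [hκ, Measure.map_apply (by fun_prop) (measurable_prodMk_left (hd hS))]
    congr 1
    ext u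
    simp
  have := Measure.isProbabilityMeasure_map (μ := P) hX.aemeasurable
  have hU : Measurable fun ω ↦ Y ω - v (X ω) := by fun_prop
  have hγ : P.map (fun ω ↦ Y ω - v (X ω)) = γ := by
    have := congrArg Measure.snd hmap
    rwa [Measure.snd_prod, Measure.snd_map_prodMk hX] at this
  refine ⟨?_, hγ⟩
  rw [indepFun_iff_map_prod_eq_prod_map_map hX.aemeasurable hU.aemeasurable, hγ, hmap]

end Conditioning

/-! ### Conditioning on a sub-σ-algebra -/

section SigmaAlgebras

variable {Ω E : Type*} {m mΩ : MeasurableSpace Ω} {P : Measure Ω} [IsProbabilityMeasure P]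
  [MeasurableSpace E] [StandardBorelSpace E] [Nonempty E]
  [AddGroup E] [MeasurableAdd₂ E] [MeasurableSub₂ E]

-- A sub-σ-algebra `m` is treated as generated by the identity map from `Ω` to `Ω` equipped with
-- `m`, so results about conditioning on a variable apply to it.
omit [StandardBorelSpace E] [Nonempty E] [AddGroup E] [MeasurableAdd₂ E] [MeasurableSub₂ E]
  [IsProbabilityMeasure P] in
lemma indepFun_id_iff {U : Ω → E} :
    @IndepFun Ω Ω E mΩ m _ id U P ↔ Indep m (MeasurableSpace.comap U inferInstance) P := by
  rw [@IndepFun_iff_Indep, MeasurableSpace.comap_id]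

omit [MeasurableSub₂ E] in
lemma condExp_add_ae_eq_of_indep (hm : m ≤ mΩ) {U V : Ω → E}
    (hV : Measurable[m] V) (hU : Measurable U)
    (h : Indep m (MeasurableSpace.comap U inferInstance) P) {f : E → ℝ} (hf : Measurable f)
    (hfb : ∃ C, ∀ x, |f x| ≤ C) :
    P[fun ω ↦ f (U ω + V ω) | m] =ᵐ[P] fun ω ↦ ∫ u, f (u + V ω) ∂P.map U := by
  have hg : @Measurable _ _ (@Prod.instMeasurableSpace Ω E m _) _
      (fun p : Ω × E ↦ f (p.2 + V p.1)) :=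
    hf.comp ((@measurable_snd Ω E m _).add (hV.comp (@measurable_fst Ω E m _)))
  have := @condExp_comp_ae_eq_of_indepFun Ω Ω E mΩ P _ m _ _ _ id U (measurable_id'' hm) hU
    (indepFun_id_iff.2 h) _ hg (hfb.imp fun C hC x ↦ hC _)
  rwa [MeasurableSpace.comap_id] at this

lemma indep_sub_of_condExp (hm : m ≤ mΩ) {Y V : Ω → E}
    (hV : Measurable[m] V) (hY : Measurable Y) {γ : Measure E} [IsProbabilityMeasure γ]
    (h : ∀ S, MeasurableSet S → P[(Y ⁻¹' S).indicator (fun _ ↦ (1 : ℝ)) | m] =ᵐ[P]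
        fun ω ↦ γ.real ((fun u ↦ u + V ω) ⁻¹' S)) :
    Indep m (MeasurableSpace.comap (fun ω ↦ Y ω - V ω) inferInstance) P ∧
      P.map (fun ω ↦ Y ω - V ω) = γ := by
  have := @indepFun_sub_of_condExp Ω Ω E mΩ P _ m _ _ _ _ _ _ id Y (measurable_id'' hm) hY V hV γ _
    (by rwa [MeasurableSpace.comap_id])
  exact ⟨indepFun_id_iff.1 this.1, this.2⟩

end SigmaAlgebras

/-! ### σ-algebras of observations over sets of times -/

section TimeSets

variable {ι Ω E : Type*} [MeasurableSpace E]

/-- The σ-algebra generated by `Z τ` for `τ ∈ S`. -/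
@[reducible] def observed (Z : ι → Ω → E) (S : Set ι) : MeasurableSpace Ω :=
  ⨆ τ ∈ S, MeasurableSpace.comap (Z τ) inferInstance

lemma measurable_observed (Z : ι → Ω → E) {S : Set ι} {τ : ι} (h : τ ∈ S) :
    Measurable[observed Z S] (Z τ) := by
  rw [measurable_iff_comap_le]
  exact le_iSup₂_of_le τ h le_rfl

lemma observed_le {mΩ : MeasurableSpace Ω} {Z : ι → Ω → E} (hZ : ∀ t, Measurable (Z t))
    (S : Set ι) : observed Z S ≤ mΩ :=
  iSup₂_le fun τ _ ↦ (hZ τ).comap_le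

lemma present_sup_present (Z : ι → Ω → E) (s t : ι) :
    present Z s ⊔ present Z t = observed Z {s, t} := by
  simp only [observed, present, iSup_pair]

lemma present_eq_observed (Z : ι → Ω → E) (s : ι) : present Z s = observed Z {s} := by
  simp only [observed, present, iSup_singleton]

variable [Preorder ι]

lemma past_eq_observed (Z : ι → Ω → E) (s : ι) : past Z s = observed Z (Iic s) := rfl

lemma past_sup_future (Z : ι → Ω → E) (s t : ι) :
    past Z s ⊔ future Z t = observed Z (Iic s ∪ Ici t) := by
  simp only [observed, iSup_union]
  rfl

end TimeSets

/-! ### Gaussian regression for Ornstein–Uhlenbeck vectors -/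

section Gaussian

variable {N : ℕ} {T lam : ℝ} {Ω : Type*} {mΩ : MeasurableSpace Ω} {P : Measure Ω}
  {Z : Icc (0 : ℝ) T → Ω → EuclideanSpace ℝ (Fin N)}

/-- A Gaussian process with a finite index set is a Gaussian vector. -/
lemma hasGaussianLaw_of_fintype {ι : Type*} [Fintype ι] {X : ι → Ω → ℝ}
    (hX : IsGaussianProcess X P) : HasGaussianLaw (fun ω i ↦ X i ω) P :=
  (hX.hasGaussianLaw Finset.univ).map
    { toFun x i := x ⟨i, Finset.mem_univ i⟩
      map_add' x y := by ext; simp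
      map_smul' c x := by ext; simp }

/-- The covariance function of the stationary Ornstein-Uhlenbeck process. -/
def ouCov (lam s t : ℝ) : ℝ := Real.exp (-lam * |s - t|) / (2 * lam)

/-- A centered Gaussian process in `ℝ^N` with independent components and Ornstein-Uhlenbeck
covariances. -/
structure IsOUVector (lam : ℝ) (Z : Icc (0 : ℝ) T → Ω → EuclideanSpace ℝ (Fin N))
    (P : Measure Ω) : Prop where
  measurable : ∀ t, Measurable (Z t)
  isGaussianProcess : IsGaussianProcess (fun (p : Icc (0 : ℝ) T × Fin N) ω ↦ Z p.1 ω p.2) P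
  integral_eq_zero : ∀ t i, ∫ ω, Z t ω i ∂P = 0
  covariance : ∀ s t i j,
    cov[fun ω ↦ Z s ω i, fun ω ↦ Z t ω j; P] = if i = j then ouCov lam s t else 0

/-- The residual of `Z r` in the regression on `Z t` and `Z s`. -/
def residual (Z : Icc (0 : ℝ) T → Ω → EuclideanSpace ℝ (Fin N)) (r t s : Icc (0 : ℝ) T) (a b : ℝ)
    (ω : Ω) : EuclideanSpace ℝ (Fin N) := Z r ω - (a • Z t ω + b • Z s ω)

lemma residual_apply (r t s : Icc (0 : ℝ) T) (a b : ℝ) (ω : Ω) (i : Fin N) :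
    residual Z r t s a b ω i = Z r ω i - (a * Z t ω i + b * Z s ω i) := rfl

lemma IsOUVector.memLp (hZ : IsOUVector lam Z P) (t : Icc (0 : ℝ) T) (i : Fin N) :
    MemLp (fun ω ↦ Z t ω i) 2 P :=
  (hZ.isGaussianProcess.hasGaussianLaw_eval (t, i)).memLp_two

lemma measurable_residual (hZ : ∀ t, Measurable (Z t)) (r t s : Icc (0 : ℝ) T) (a b : ℝ) :
    Measurable (residual Z r t s a b) :=
  (hZ r).sub (((hZ t).const_smul a).add ((hZ s).const_smul b))

lemma measurable_observed_smul_add (Z : Icc (0 : ℝ) T → Ω → EuclideanSpace ℝ (Fin N))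
    {S : Set (Icc (0 : ℝ) T)} {t s : Icc (0 : ℝ) T} (ht : t ∈ S) (hs : s ∈ S) (a b : ℝ) :
    Measurable[observed Z S] fun ω ↦ a • Z t ω + b • Z s ω :=
  ((measurable_observed Z ht).const_smul a).add ((measurable_observed Z hs).const_smul b)

lemma IsOUVector.covariance_residual_left (hZ : IsOUVector lam Z P) (r t s : Icc (0 : ℝ) T)
    (a b : ℝ) (i : Fin N) {Y : Ω → ℝ} (hY : MemLp Y 2 P) :
    cov[fun ω ↦ residual Z r t s a b ω i, Y; P] = cov[fun ω ↦ Z r ω i, Y; P] -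
      (a * cov[fun ω ↦ Z t ω i, Y; P] + b * cov[fun ω ↦ Z s ω i, Y; P]) := by
  have := hZ.isGaussianProcess.isProbabilityMeasure
  simp only [residual_apply]
  have h : MemLp (fun ω ↦ a * Z t ω i + b * Z s ω i) 2 P :=
    ((hZ.memLp t i).const_mul a).add ((hZ.memLp s i).const_mul b)
  rw [covariance_fun_sub_left (hZ.memLp r i) h hY,
    show (fun ω ↦ a * Z t ω i + b * Z s ω i) = (fun ω ↦ a * Z t ω i) + fun ω ↦ b * Z s ω i from rfl,
    covariance_add_left ((hZ.memLp t i).const_mul a) ((hZ.memLp s i).const_mul b) hY,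
    covariance_const_mul_left, covariance_const_mul_left]

lemma IsOUVector.isGaussianProcess_residual (hZ : IsOUVector lam Z P) (r t s : Icc (0 : ℝ) T)
    (a b : ℝ) : IsGaussianProcess (Sum.elim (fun (i : Fin N) ω ↦ residual Z r t s a b ω i)
      (fun (p : Icc (0 : ℝ) T × Fin N) ω ↦ Z p.1 ω p.2)) P := by
  classical
  refine hZ.isGaussianProcess.of_isGaussianProcess ?_
  rintro (i | p)
  · exact ⟨{(r, i), (t, i), (s, i)},
      { toFun x := x ⟨(r, i), by simp⟩ - (a * x ⟨(t, i), by simp⟩ + b * x ⟨(s, i), by simp⟩)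
        map_add' x y := by simp; ring
        map_smul' c x := by simp; ring }, fun ω ↦ rfl⟩
  · exact ⟨{p},
      { toFun x := x ⟨p, by simp⟩
        map_add' x y := by simp
        map_smul' c x := by simp }, fun ω ↦ rfl⟩

/-- If the regression equations hold at all times of `S`, the residual is independent of the
process on `S`, with an isotropic Gaussian law. -/
lemma IsOUVector.indep_residual (hZ : IsOUVector lam Z P) {r t s : Icc (0 : ℝ) T} {a b : ℝ}
    {S : Set (Icc (0 : ℝ) T)} (ht : t ∈ S) (hs : s ∈ S)
    (hS : ∀ τ ∈ S, ouCov lam r τ = a * ouCov lam t τ + b * ouCov lam s τ) {v : ℝ≥0}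
    (hv : (v : ℝ) = ouCov lam r r - (a * ouCov lam t r + b * ouCov lam s r)) :
    Indep (observed Z S) (MeasurableSpace.comap (residual Z r t s a b) inferInstance) P ∧
      HasLaw (residual Z r t s a b) (isoGaussian N v) P := by
  have := hZ.isGaussianProcess.isProbabilityMeasure
  have hG := hZ.isGaussianProcess_residual r t s a b
  have hcov (τ : Icc (0 : ℝ) T) (i j : Fin N) :
      cov[fun ω ↦ residual Z r t s a b ω i, fun ω ↦ Z τ ω j; P] =
        if i = j then ouCov lam r τ - (a * ouCov lam t τ + b * ouCov lam s τ) else 0 := by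
    rw [hZ.covariance_residual_left r t s a b i (hZ.memLp τ j), hZ.covariance, hZ.covariance,
      hZ.covariance]
    split_ifs <;> ring
  constructor
  · have h1 : IsGaussianProcess (Sum.elim (fun (i : Fin N) ω ↦ residual Z r t s a b ω i)
        (fun (p : S × Fin N) ω ↦ Z p.1 ω p.2)) P := by
      have h := hG.comp_right (Sum.map id (Prod.map Subtype.val id) :
        Fin N ⊕ (S × Fin N) → Fin N ⊕ (Icc (0 : ℝ) T × Fin N))
      rwa [Sum.elim_comp_map] at h
    have h2 := h1.indepFun_of_covariance_eq_zero
      (fun i ↦ (hG.aemeasurable (.inl i))) (fun p ↦ (hG.aemeasurable (.inr (p.1.1, p.2))))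
      fun i p ↦ by
        rw [hcov]
        split_ifs
        · rw [hS _ p.1.2, sub_self]
        · rfl
    rw [IndepFun_iff_Indep] at h2
    -- The independence obtained concerns families of real coordinates; both vector σ-algebras are
    -- contained in those they generate.
    refine indep_of_indep_of_le_left (indep_of_indep_of_le_right h2.symm ?_) ?_
    · have e : residual Z r t s a b = (WithLp.toLp 2) ∘ fun ω i ↦ residual Z r t s a b ω i := rfl
      rw [e, ← MeasurableSpace.comap_comp]
      refine MeasurableSpace.comap_mono ?_
      rw [← measurable_iff_comap_le]
      fun_prop
    · refine iSup₂_le fun τ hτ ↦ ?_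
      have e : Z τ = (fun x : S × Fin N → ℝ ↦ WithLp.toLp 2 fun i ↦ x (⟨τ, hτ⟩, i)) ∘
        fun ω (p : S × Fin N) ↦ Z p.1 ω p.2 := rfl
      rw [e, ← MeasurableSpace.comap_comp]
      refine MeasurableSpace.comap_mono ?_
      rw [← measurable_iff_comap_le]
      fun_prop
  · have hU (i : Fin N) : MemLp (fun ω ↦ residual Z r t s a b ω i) 2 P :=
      (hG.hasGaussianLaw_eval (.inl i)).memLp_two
    refine hasLaw_isoGaussian ?_ (fun i ↦ ?_) fun i j ↦ ?_
    · exact hasGaussianLaw_of_fintype (hG.comp_right Sum.inl)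
    · simp only [residual_apply]
      have hi (τ : Icc (0 : ℝ) T) : Integrable (fun ω ↦ Z τ ω i) P :=
        (hZ.memLp τ i).integrable (by norm_num)
      have h : Integrable (fun ω ↦ a * Z t ω i + b * Z s ω i) P :=
        ((hi t).const_mul a).add ((hi s).const_mul b)
      rw [integral_sub (hi r) h,
        integral_add ((hi t).const_mul a) ((hi s).const_mul b), integral_const_mul,
        integral_const_mul, hZ.integral_eq_zero, hZ.integral_eq_zero, hZ.integral_eq_zero]
      ring
    -- Only one copy of the residual is expanded: its covariances with `Z t` and `Z s` vanish
    -- because `t, s ∈ S`, leaving the covariance with `Z r`.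
    · rw [covariance_comm, hZ.covariance_residual_left r t s a b j (hU i), covariance_comm,
        covariance_comm (fun ω ↦ Z t ω j), covariance_comm (fun ω ↦ Z s ω j), hcov, hcov, hcov,
        hS t ht, hS s hs, hv]
      split_ifs <;> ring

/-- The regression formula for conditional expectations. -/
lemma IsOUVector.condExp (hZ : IsOUVector lam Z P) {r t s : Icc (0 : ℝ) T} {a b : ℝ}
    {S : Set (Icc (0 : ℝ) T)} (ht : t ∈ S) (hs : s ∈ S)
    (hS : ∀ τ ∈ S, ouCov lam r τ = a * ouCov lam t τ + b * ouCov lam s τ) {v : ℝ≥0}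
    (hv : (v : ℝ) = ouCov lam r r - (a * ouCov lam t r + b * ouCov lam s r))
    {f : EuclideanSpace ℝ (Fin N) → ℝ} (hf : Measurable f) (hfb : ∃ C, ∀ x, |f x| ≤ C) :
    P[fun ω ↦ f (Z r ω) | observed Z S] =ᵐ[P]
      fun ω ↦ ∫ u, f (u + (a • Z t ω + b • Z s ω)) ∂isoGaussian N v := by
  have := hZ.isGaussianProcess.isProbabilityMeasure
  obtain ⟨h1, h2⟩ := hZ.indep_residual ht hs hS hv
  have h3 := condExp_add_ae_eq_of_indep (observed_le hZ.measurable S)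
    (measurable_observed_smul_add Z ht hs a b)
    (measurable_residual hZ.measurable r t s a b) h1 hf hfb
  rw [h2.map_eq] at h3
  have e (ω : Ω) : residual Z r t s a b ω + (a • Z t ω + b • Z s ω) = Z r ω := by
    simp [residual]
  simpa only [e] using h3

end Gaussian

/-! ### Bridge coefficients and the exponential covariance -/

section Bridge

/-- The coefficient of `Z t` in the conditional mean of `Z r` given `Z s` and `Z t`. -/
def bridgeCoeff (lam s r t : ℝ) : ℝ := Real.sinh (lam * (r - s)) / Real.sinh (lam * (t - s))

/-- The coefficient of `Z s` in the conditional mean of `Z r` given `Z s` and `Z t`. -/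
def bridgeCoeff' (lam s r t : ℝ) : ℝ := Real.sinh (lam * (t - r)) / Real.sinh (lam * (t - s))

/-- The conditional variance of `Z r` given `Z s` and `Z t`. -/
def bridgeVar (lam s r t : ℝ) : ℝ≥0 :=
  (Real.sinh (lam * (r - s)) * Real.sinh (lam * (t - r)) /
    (lam * Real.sinh (lam * (t - s)))).toNNReal

variable {lam s r t τ : ℝ}

lemma coe_bridgeVar_pos (hlam : 0 < lam) (hsr : s < r) (hrt : r < t) :
    0 < Real.sinh (lam * (r - s)) * Real.sinh (lam * (t - r)) /
      (lam * Real.sinh (lam * (t - s))) := by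
  have h1 : 0 < Real.sinh (lam * (r - s)) :=
    Real.sinh_pos_iff.2 (mul_pos hlam (sub_pos.2 hsr))
  have h2 : 0 < Real.sinh (lam * (t - r)) :=
    Real.sinh_pos_iff.2 (mul_pos hlam (sub_pos.2 hrt))
  have h3 : 0 < Real.sinh (lam * (t - s)) :=
    Real.sinh_pos_iff.2 (mul_pos hlam (sub_pos.2 (hsr.trans hrt)))
  positivity

lemma coe_bridgeVar (hlam : 0 < lam) (hsr : s < r) (hrt : r < t) :
    (bridgeVar lam s r t : ℝ) = Real.sinh (lam * (r - s)) * Real.sinh (lam * (t - r)) /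
      (lam * Real.sinh (lam * (t - s))) :=
  Real.coe_toNNReal _ (coe_bridgeVar_pos hlam hsr hrt).le

lemma bridgeVar_ne_zero (hlam : 0 < lam) (hsr : s < r) (hrt : r < t) :
    bridgeVar lam s r t ≠ 0 := by
  rw [← NNReal.coe_ne_zero, coe_bridgeVar hlam hsr hrt]
  exact (coe_bridgeVar_pos hlam hsr hrt).ne'

lemma ouCov_comm (lam s t : ℝ) : ouCov lam s t = ouCov lam t s := by
  rw [ouCov, ouCov, abs_sub_comm]

lemma ouCov_self (lam s : ℝ) : ouCov lam s s = 1 / (2 * lam) := by simp [ouCov]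

lemma ouCov_of_le (h : s ≤ t) : ouCov lam t s = Real.exp (-(lam * (t - s))) / (2 * lam) := by
  rw [ouCov, abs_of_nonneg (sub_nonneg.2 h), neg_mul]

lemma ouCov_markov (hrs : τ ≤ s) (hst : s ≤ t) :
    ouCov lam t τ = Real.exp (-lam * (t - s)) * ouCov lam s τ := by
  rw [ouCov_of_le (hrs.trans hst), ouCov_of_le hrs, ← mul_div_assoc, ← Real.exp_add]
  congr 2
  ring

lemma exp_neg_mul_sinh_add (p q : ℝ) : Real.sinh (p + q) * Real.exp (-p) =
    Real.sinh p * Real.exp (-(p + q)) + Real.sinh q := by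
  simp only [Real.sinh_eq, neg_add, Real.exp_add, Real.exp_neg]
  field_simp
  ring

/-- On `[s, t]` the covariance with time `τ` solves `u'' = λ² u`, so it is interpolated by `sinh`
from its endpoint values. After factoring out `ouCov lam s τ` this is `exp_neg_mul_sinh_add`. -/
lemma ouCov_bridge_of_le (hlam : 0 < lam) (hsr : s < r) (hrt : r < t) (h : τ ≤ s) :
    ouCov lam r τ =
      bridgeCoeff lam s r t * ouCov lam t τ + bridgeCoeff' lam s r t * ouCov lam s τ := by
  have h3 : Real.sinh (lam * (t - s)) ≠ 0 :=
    (Real.sinh_pos_iff.2 (mul_pos hlam (sub_pos.2 (hsr.trans hrt)))).ne'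
  rw [ouCov_markov h hsr.le, ouCov_markov h (hsr.trans hrt).le, bridgeCoeff, bridgeCoeff']
  have e := exp_neg_mul_sinh_add (lam * (r - s)) (lam * (t - r))
  rw [show lam * (r - s) + lam * (t - r) = lam * (t - s) by ring] at e
  field_simp
  rw [← neg_mul] at e
  simp only [neg_mul] at e ⊢
  linear_combination ouCov lam s τ * e

lemma ouCov_bridge_of_ge (hlam : 0 < lam) (hsr : s < r) (hrt : r < t) (h : t ≤ τ) :
    ouCov lam r τ =
      bridgeCoeff lam s r t * ouCov lam t τ + bridgeCoeff' lam s r t * ouCov lam s τ := by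
  -- Time reversal exchanges the roles of `s` and `t`.
  have e := ouCov_bridge_of_le hlam (neg_lt_neg hrt) (neg_lt_neg hsr) (neg_le_neg h)
  have hc (x y : ℝ) : ouCov lam (-x) (-y) = ouCov lam x y := by
    rw [ouCov_comm lam x, ouCov, ouCov]
    congr 4
    ring
  simp only [hc, bridgeCoeff, bridgeCoeff'] at e ⊢
  rw [e, add_comm]
  congr 3 <;> ring_nf

lemma coe_bridgeVar_eq (hlam : 0 < lam) (hsr : s < r) (hrt : r < t) :
    (bridgeVar lam s r t : ℝ) = ouCov lam r r -
      (bridgeCoeff lam s r t * ouCov lam t r + bridgeCoeff' lam s r t * ouCov lam s r) := by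
  have h3 : Real.sinh (lam * (t - s)) ≠ 0 :=
    (Real.sinh_pos_iff.2 (mul_pos hlam (sub_pos.2 (hsr.trans hrt)))).ne'
  rw [coe_bridgeVar hlam hsr hrt, ouCov_comm lam s r, ouCov_self, ouCov_of_le hrt.le,
    ouCov_of_le hsr.le, bridgeCoeff, bridgeCoeff']
  field_simp
  rw [show lam * (t - s) = lam * (r - s) + lam * (t - r) by ring]
  generalize lam * (r - s) = p
  generalize lam * (t - r) = q
  simp only [Real.sinh_eq, neg_add, Real.exp_add, Real.exp_neg]
  field_simp
  ring

lemma bernsteinTransition_mehlerKernel (hlam : 0 < lam) (hsr : s < r) (hrt : r < t) {N : ℕ}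
    (x y : EuclideanSpace ℝ (Fin N)) {E : Set (EuclideanSpace ℝ (Fin N))} (hE : MeasurableSet E) :
    bernsteinTransition (mehlerKernel N lam) x t E r y s =
      (isoGaussian N (bridgeVar lam s r t)).real
        ((fun u ↦ u + (bridgeCoeff lam s r t • x + bridgeCoeff' lam s r t • y)) ⁻¹' E) := by
  set m := bridgeCoeff lam s r t • x + bridgeCoeff' lam s r t • y with hm
  rw [isoGaussian_real_apply N (bridgeVar_ne_zero hlam hsr hrt) (measurable_add_const m hE),
    bernsteinTransition,
    ← (measurePreserving_add_right volume m).setIntegral_preimage_emb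
      (measurableEmbedding_addRight m)]
  refine setIntegral_congr_fun (measurable_add_const m hE) fun z _ ↦ ?_
  rw [bernsteinDensity_mehlerKernel hlam hsr hrt, coe_bridgeVar hlam hsr hrt]
  congr 1
  rw [hm, bridgeCoeff, bridgeCoeff', add_sub_cancel_right]

end Bridge

/-! ### Joint law of the endpoints -/

section JointLaw

variable {N : ℕ} {Ω : Type*} {mΩ : MeasurableSpace Ω} {P : Measure Ω} [IsProbabilityMeasure P]

/-- The pair is the image of two independent Gaussians under a shear that preserves Lebesgue
measure, so its density is the product found in `groundState_mul_mehlerKernel`. -/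
lemma map_eq_markovianMeasure {lam T : ℝ} (hlam : 0 < lam) (hT : 0 < T)
    {U V : Ω → EuclideanSpace ℝ (Fin N)} {v w : ℝ≥0} (hv : (v : ℝ) = 1 / (2 * lam))
    (hw : (w : ℝ) = (1 - Real.exp (-lam * T) ^ 2) / (2 * lam))
    (hU : HasLaw U (isoGaussian N v) P)
    (hV : HasLaw (fun ω ↦ V ω - Real.exp (-lam * T) • U ω) (isoGaussian N w) P)
    (h : IndepFun U (fun ω ↦ V ω - Real.exp (-lam * T) • U ω) P) :
    P.map (fun ω ↦ (U ω, V ω)) = markovianMeasure (mehlerKernel N lam) T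
      (groundStateMeasure N lam T) (groundStateMeasure N lam T) := by
  set c := Real.exp (-lam * T) with hc
  have hc1 : c ^ 2 < 1 := by
    rw [hc, ← Real.exp_nat_mul, Real.exp_lt_one_iff]
    push_cast
    nlinarith [mul_pos hlam hT]
  have hv0 : v ≠ 0 := by rw [← NNReal.coe_ne_zero, hv]; positivity
  have hw0 : w ≠ 0 := by
    rw [← NNReal.coe_ne_zero, hw]
    have : 0 < 1 - c ^ 2 := by linarith
    positivity
  let e : EuclideanSpace ℝ (Fin N) × EuclideanSpace ℝ (Fin N) →
    EuclideanSpace ℝ (Fin N) × EuclideanSpace ℝ (Fin N) := fun p ↦ (p.1, p.2 + c • p.1)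
  have he : MeasurePreserving e ((volume : Measure (EuclideanSpace ℝ (Fin N))).prod volume)
      (volume.prod volume) :=
    (MeasurePreserving.id volume).skew_product (g := fun x z ↦ z + c • x) (by fun_prop)
      (ae_of_all _ fun x ↦ (measurePreserving_add_right volume (c • x)).map_eq)
  have hmap : P.map (fun ω ↦ (U ω, V ω)) = ((isoGaussian N v).prod (isoGaussian N w)).map e := by
    rw [← hU.map_eq, ← hV.map_eq, ← (indepFun_iff_map_prod_eq_prod_map_map hU.aemeasurable
      hV.aemeasurable).1 h, AEMeasurable.map_map_of_aemeasurable he.measurable.aemeasurable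
      (hU.aemeasurable.prodMk hV.aemeasurable)]
    congr 1
    ext ω : 1
    simp [e]
  have hg : Measurable fun q : EuclideanSpace ℝ (Fin N) × EuclideanSpace ℝ (Fin N) ↦
      ENNReal.ofReal (mehlerKernel N lam q.1 T q.2) := by
    unfold mehlerKernel
    fun_prop
  have hd : Measurable fun x ↦ ENNReal.ofReal (groundStateDensity N lam T x) := by
    unfold groundStateDensity
    fun_prop
  have hd2 : Measurable fun q : EuclideanSpace ℝ (Fin N) × EuclideanSpace ℝ (Fin N) ↦
      ENNReal.ofReal (groundStateDensity N lam T q.1) *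
        ENNReal.ofReal (groundStateDensity N lam T q.2) :=
    (hd.comp measurable_fst).mul (hd.comp measurable_snd)
  have hi (u : ℝ) : Measurable fun x : EuclideanSpace ℝ (Fin N) ↦ ENNReal.ofReal (isoDensity N u x) :=
    (measurable_isoDensity N u).ennreal_ofReal
  have hd0 (x : EuclideanSpace ℝ (Fin N)) : 0 ≤ groundStateDensity N lam T x := by
    unfold groundStateDensity
    positivity
  rw [hmap, isoGaussian_eq_withDensity N hv0, isoGaussian_eq_withDensity N hw0,
    prod_withDensity (hi _) (hi _), markovianMeasure, groundStateMeasure, prod_withDensity hd hd,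
    ← withDensity_mul _ hd2 hg]
  ext A hA
  rw [Measure.map_apply he.measurable hA, withDensity_apply _ (he.measurable hA),
    withDensity_apply _ hA, ← he.setLIntegral_comp_preimage hA (hd2.mul hg)]
  refine lintegral_congr fun p ↦ ?_
  simp only [Pi.mul_apply, e]
  rw [← ENNReal.ofReal_mul (isoDensity_nonneg N v.coe_nonneg _), ← ENNReal.ofReal_mul (hd0 _),
    ← ENNReal.ofReal_mul (mul_nonneg (hd0 _) (hd0 _)), groundState_mul_mehlerKernel hlam hT, hv, hw,
    add_sub_cancel_right]

end JointLaw

/-! ### Ornstein–Uhlenbeck vectors are Markov and Bernstein -/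

section OUVector

variable {N : ℕ} {T lam : ℝ} {Ω : Type*} {mΩ : MeasurableSpace Ω} {P : Measure Ω}
  {Z : Icc (0 : ℝ) T → Ω → EuclideanSpace ℝ (Fin N)}

/-- Regression on `Z s` alone, with the second coefficient equal to `0`, is valid against every time
up to `s`. The same formula thus computes the expectation given the past and given the present. For
`s = t` the residual variance is `0`. -/
lemma IsOUVector.isMarkovProcess (hlam : 0 < lam) (hZ : IsOUVector lam Z P) :
    IsMarkovProcess Z P := by
  refine ⟨hZ.measurable, fun s t hst f hf hfb ↦ ?_⟩
  set c := Real.exp (-lam * (t - s)) with hc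
  have hc1 : c ^ 2 ≤ 1 := by
    rw [hc, ← Real.exp_nat_mul, Real.exp_le_one_iff]
    have : 0 ≤ (t : ℝ) - s := sub_nonneg.2 hst
    push_cast
    nlinarith [mul_nonneg hlam.le this]
  have hv : ((((1 - c ^ 2) / (2 * lam)).toNNReal : ℝ≥0) : ℝ) =
      ouCov lam t t - (c * ouCov lam s t + 0 * ouCov lam s t) := by
    rw [Real.coe_toNNReal _ (div_nonneg (by linarith) (by positivity)), ouCov_comm lam s t,
      ouCov_markov le_rfl hst, ← hc, ouCov_self, ouCov_self]
    ring
  have hS (τ : Icc (0 : ℝ) T) (h : τ ≤ s) :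
      ouCov lam t τ = c * ouCov lam s τ + 0 * ouCov lam s τ := by
    rw [ouCov_markov (s := s) h hst]
    ring
  rw [past_eq_observed, present_eq_observed]
  exact (hZ.condExp (mem_Iic.2 le_rfl) (mem_Iic.2 le_rfl) hS hv hf hfb).trans
    (hZ.condExp (mem_singleton s) (mem_singleton s)
      (fun τ h ↦ hS τ (le_of_eq (mem_singleton_iff.1 h))) hv hf hfb).symm

lemma IsOUVector.hasLaw (hlam : 0 < lam) (hZ : IsOUVector lam Z P) (t : Icc (0 : ℝ) T) :
    HasLaw (Z t) (isoGaussian N (1 / (2 * lam)).toNNReal) P := by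
  refine hasLaw_isoGaussian ?_ (hZ.integral_eq_zero t) fun i j ↦ ?_
  · exact hasGaussianLaw_of_fintype (hZ.isGaussianProcess.comp_right fun i ↦ (t, i))
  · rw [hZ.covariance, ouCov_self, Real.coe_toNNReal _ (by positivity)]

/-- One regression formula serves for both `Iic s ∪ Ici t` and `{s, t}`, which gives (i), and for
indicators it is the Mehler transition of (ii). The endpoint law comes from the independent residual
`Z T - exp (-λT) Z 0`. -/
lemma IsOUVector.isAssociatedBernsteinProcess (hlam : 0 < lam) (hT : 0 < T)
    (hZ : IsOUVector lam Z P) :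
    IsAssociatedBernsteinProcess hT (mehlerKernel N lam) (groundStateMeasure N lam T)
      (groundStateMeasure N lam T) Z P := by
  have := hZ.isGaussianProcess.isProbabilityMeasure
  have hS {s r t τ : Icc (0 : ℝ) T} (hsr : s < r) (hrt : r < t) (h : τ ∈ Iic s ∪ Ici t) :
      ouCov lam r τ = bridgeCoeff lam s r t * ouCov lam t τ +
        bridgeCoeff' lam s r t * ouCov lam s τ :=
    h.elim (fun h ↦ ouCov_bridge_of_le hlam hsr hrt h) fun h ↦ ouCov_bridge_of_ge hlam hsr hrt h
  have h2 {s r t : Icc (0 : ℝ) T} (hsr : s < r) (hrt : r < t)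
      {f : EuclideanSpace ℝ (Fin N) → ℝ} (hf : Measurable f) (hfb : ∃ C, ∀ x, |f x| ≤ C) :=
    hZ.condExp (S := {s, t}) (by simp) (by simp) (fun τ hτ ↦ hS hsr hrt (by
      rcases hτ with rfl | rfl <;> simp)) (coe_bridgeVar_eq hlam hsr hrt) hf hfb
  refine ⟨⟨hZ.measurable, fun s r t hsr hrt f hf hfb ↦ ?_⟩, fun s r t hsr hrt E hE ↦ ?_, ?_⟩
  · rw [past_sup_future, present_sup_present]
    exact (hZ.condExp (by simp) (by simp) (fun τ hτ ↦ hS hsr hrt hτ)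
      (coe_bridgeVar_eq hlam hsr hrt) hf hfb).trans (h2 hsr hrt hf hfb).symm
  · rw [present_sup_present]
    refine (h2 hsr hrt (f := E.indicator fun _ ↦ 1) (measurable_const.indicator hE)
      ⟨1, fun x ↦ by by_cases hx : x ∈ E <;> simp [hx]⟩).trans (ae_of_all _ fun ω ↦ ?_)
    simp only
    rw [bernsteinTransition_mehlerKernel hlam hsr hrt _ _ hE,
      ← integral_indicator_one (measurable_add_const _ hE)]
    rfl
  · set z : Icc (0 : ℝ) T := ⟨0, left_mem_Icc.2 hT.le⟩
    set e : Icc (0 : ℝ) T := ⟨T, right_mem_Icc.2 hT.le⟩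
    have hze : (z : ℝ) ≤ e := hT.le
    set c := Real.exp (-lam * T) with hc
    have hc1 : c ^ 2 ≤ 1 := by
      rw [hc, ← Real.exp_nat_mul, Real.exp_le_one_iff]
      push_cast
      nlinarith [mul_pos hlam hT]
    have hcov (τ : Icc (0 : ℝ) T) (h : τ ≤ z) :
        ouCov lam e τ = c * ouCov lam z τ + 0 * ouCov lam z τ := by
      rw [ouCov_markov (s := z) h hze, zero_mul, add_zero, hc]
      simp [z, e]
    have hw : ((((1 - c ^ 2) / (2 * lam)).toNNReal : ℝ≥0) : ℝ) = (1 - c ^ 2) / (2 * lam) :=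
      Real.coe_toNNReal _ (div_nonneg (by linarith) (by positivity))
    obtain ⟨h3, h4⟩ := hZ.indep_residual (S := {z}) rfl rfl
      (fun τ hτ ↦ hcov τ (le_of_eq (mem_singleton_iff.1 hτ))) (hw.trans (by
        rw [ouCov_comm lam z e, hcov z le_rfl, ouCov_self, ouCov_self]
        ring))
    have e1 : residual Z e z z c 0 = fun ω ↦ Z e ω - c • Z z ω := by
      ext ω : 1
      simp [residual]
    rw [e1] at h3 h4
    rw [← present_eq_observed] at h3
    exact map_eq_markovianMeasure hlam hT
      (Real.coe_toNNReal _ (by positivity)) hw (hZ.hasLaw hlam z) h4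
      ((IndepFun_iff_Indep _ _ _).2 h3)

end OUVector

/-! ### Uniqueness in law -/

section Uniqueness

variable {N : ℕ} {T lam : ℝ} {Ω Ω' : Type*} {mΩ : MeasurableSpace Ω} {P : Measure Ω}
  {mΩ' : MeasurableSpace Ω'} {P' : Measure Ω'}
  {Z : Icc (0 : ℝ) T → Ω → EuclideanSpace ℝ (Fin N)}
  {Z' : Icc (0 : ℝ) T → Ω' → EuclideanSpace ℝ (Fin N)}

/-- The Bernstein property upgrades the transition law given `Z s, Z t` to one given all outer
times. That law is a fixed Gaussian translated by a linear function of `Z t` and `Z s`, so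
`indep_sub_of_condExp` applies. -/
lemma IsAssociatedBernsteinProcess.indep_residual [IsProbabilityMeasure P] (hlam : 0 < lam)
    {hT : 0 < T} {φ ψ : Measure (EuclideanSpace ℝ (Fin N))}
    (hZ : IsAssociatedBernsteinProcess hT (mehlerKernel N lam) φ ψ Z P)
    {s r t : Icc (0 : ℝ) T} (hsr : s < r) (hrt : r < t) :
    Indep (observed Z (Iic s ∪ Ici t)) (MeasurableSpace.comap
      (residual Z r t s (bridgeCoeff lam s r t) (bridgeCoeff' lam s r t)) inferInstance) P ∧
    P.map (residual Z r t s (bridgeCoeff lam s r t) (bridgeCoeff' lam s r t)) =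
      isoGaussian N (bridgeVar lam s r t) := by
  have hm := hZ.isBernsteinProcess.measurable
  have ht : t ∈ Iic s ∪ Ici t := Or.inr (mem_Ici.2 le_rfl)
  have hs : s ∈ Iic s ∪ Ici t := Or.inl (mem_Iic.2 le_rfl)
  refine indep_sub_of_condExp (observed_le hm _) 
    (measurable_observed_smul_add Z ht hs _ _) (hm r) fun E hE ↦ ?_
  rw [← past_sup_future]
  refine (hZ.isBernsteinProcess.condExp_eq s r t hsr hrt (E.indicator fun _ ↦ 1)
    (measurable_const.indicator hE)
    ⟨1, fun x ↦ by by_cases hx : x ∈ E <;> simp [hx]⟩).trans ?_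
  refine (hZ.transition s r t hsr hrt E hE).trans (ae_of_all _ fun ω ↦ ?_)
  exact bernsteinTransition_mehlerKernel hlam hsr hrt _ _ hE

lemma integral_exp_add_mul_I_of_indep {α E : Type*} {m mα : MeasurableSpace α}
    {μ : Measure α} [IsProbabilityMeasure μ]
    [NormedAddCommGroup E] [NormedSpace ℝ E] [MeasurableSpace E] [BorelSpace E]
    (hm : m ≤ mα) {U : α → E} {V : α → ℝ} (hU : Measurable U)
    (hV : Measurable[m] V) (h : Indep m (MeasurableSpace.comap U inferInstance) μ)
    (l : StrongDual ℝ E) :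
    ∫ x, Complex.exp (((l (U x) + V x : ℝ) : ℂ) * Complex.I) ∂μ =
      charFunDual (μ.map U) l * ∫ x, Complex.exp (V x * Complex.I) ∂μ := by
  have hind : IndepFun U V μ :=
    (IndepFun_iff_Indep _ _ _).2 (indep_of_indep_of_le_right h.symm hV.comap_le)
  have hV' : Measurable V := hV.mono hm le_rfl
  have hind2 : IndepFun (fun x ↦ Complex.exp (l (U x) * Complex.I))
      (fun x ↦ Complex.exp (V x * Complex.I)) μ :=
    hind.comp (φ := fun x ↦ Complex.exp (l x * Complex.I))
      (ψ := fun x : ℝ ↦ Complex.exp (x * Complex.I)) (by fun_prop) (by fun_prop)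
  rw [charFunDual_apply, integral_map hU.aemeasurable (by fun_prop),
    ← hind2.integral_fun_mul_eq_mul_integral
      (Measurable.aestronglyMeasurable (by fun_prop))
      (Measurable.aestronglyMeasurable (by fun_prop))]
  simp only [Complex.ofReal_add, add_mul, Complex.exp_add]

lemma IsAssociatedBernsteinProcess.integral_exp_sum_pair
    {hT : 0 < T} {g : EuclideanSpace ℝ (Fin N) → ℝ → EuclideanSpace ℝ (Fin N) → ℝ}
    {φ ψ : Measure (EuclideanSpace ℝ (Fin N))}
    (hZ : IsAssociatedBernsteinProcess hT g φ ψ Z P)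
    {z e : Icc (0 : ℝ) T} (hz : (z : ℝ) = 0) (he : (e : ℝ) = T) (hze : z ≠ e)
    (l : Icc (0 : ℝ) T → StrongDual ℝ (EuclideanSpace ℝ (Fin N))) :
    ∫ ω, Complex.exp ((∑ τ ∈ insert z (insert e ∅), l τ (Z τ ω) : ℝ) * Complex.I) ∂P =
      ∫ p, Complex.exp ((l z p.1 + l e p.2 : ℝ) * Complex.I) ∂markovianMeasure g T φ ψ := by
  have hz' : z = ⟨0, left_mem_Icc.2 hT.le⟩ := Subtype.ext hz
  have he' : e = ⟨T, right_mem_Icc.2 hT.le⟩ := Subtype.ext he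
  have hm := hZ.isBernsteinProcess.measurable
  rw [← hZ.jointLaw, integral_map ((hm _).prodMk (hm _)).aemeasurable (by fun_prop)]
  simp only [insert_empty_eq, Finset.sum_pair hze, ← hz', ← he']

/-- Writing `Z r` as the independent residual plus its linear prediction splits off a Gaussian
factor; the prediction is absorbed into the functionals at `e` and `s`. -/
lemma IsAssociatedBernsteinProcess.integral_exp_sum_insert [IsProbabilityMeasure P]
    (hlam : 0 < lam) {hT : 0 < T} {φ ψ : Measure (EuclideanSpace ℝ (Fin N))}
    (hZ : IsAssociatedBernsteinProcess hT (mehlerKernel N lam) φ ψ Z P)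
    {s r e : Icc (0 : ℝ) T} (hsr : s < r) (hre : r < e) {S : Finset (Icc (0 : ℝ) T)}
    (hr : r ∉ S) (he : e ∈ S) (hs : s ∈ S) (hS : ∀ τ ∈ S, τ ∈ Iic s ∪ Ici e)
    (l : Icc (0 : ℝ) T → StrongDual ℝ (EuclideanSpace ℝ (Fin N))) :
    ∫ ω, Complex.exp ((∑ τ ∈ insert r S, l τ (Z τ ω) : ℝ) * Complex.I) ∂P =
      charFunDual (isoGaussian N (bridgeVar lam s r e)) (l r) *
        ∫ ω, Complex.exp ((∑ τ ∈ S, (l + Pi.single e (bridgeCoeff lam s r e • l r) +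
          Pi.single s (bridgeCoeff' lam s r e • l r) :
            Icc (0 : ℝ) T → StrongDual ℝ (EuclideanSpace ℝ (Fin N))) τ (Z τ ω) : ℝ) * Complex.I) ∂P := by
  have hsingle (c : StrongDual ℝ (EuclideanSpace ℝ (Fin N))) {τ₀ : Icc (0 : ℝ) T}
      (h : τ₀ ∈ S) (x : Icc (0 : ℝ) T → EuclideanSpace ℝ (Fin N)) :
      ∑ τ ∈ S, (Pi.single τ₀ c : Icc (0 : ℝ) T → StrongDual ℝ (EuclideanSpace ℝ (Fin N))) τ
        (x τ) = c (x τ₀) := by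
    rw [Finset.sum_eq_single_of_mem τ₀ h fun τ _ hτ ↦ by simp [hτ]]
    simp
  set l' : Icc (0 : ℝ) T → StrongDual ℝ (EuclideanSpace ℝ (Fin N)) := l + Pi.single e (bridgeCoeff lam s r e • l r) +
    Pi.single s (bridgeCoeff' lam s r e • l r) with hl'
  have hm := hZ.isBernsteinProcess.measurable
  obtain ⟨h1, h2⟩ := hZ.indep_residual hlam hsr hre
  have hV : Measurable[observed Z (Iic s ∪ Ici e)] fun ω ↦ ∑ τ ∈ S, l' τ (Z τ ω) :=
    Finset.measurable_fun_sum _ fun τ hτ ↦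
      (l' τ).continuous.measurable.comp (measurable_observed Z (hS τ hτ))
  rw [← h2, ← integral_exp_add_mul_I_of_indep (observed_le hm _)
    (measurable_residual hm _ _ _ _ _) hV h1]
  refine integral_congr_ae (ae_of_all _ fun ω ↦ ?_)
  simp only
  congr 3
  rw [Finset.sum_insert hr]
  simp only [hl', Pi.add_apply, add_apply, Finset.sum_add_distrib]
  rw [hsingle _ he (fun τ ↦ Z τ ω), hsingle _ hs (fun τ ↦ Z τ ω), residual]
  simp only [map_sub, map_add, map_smul, smul_apply, smul_eq_mul]
  ring

lemma integral_exp_sum_eq [IsProbabilityMeasure P] [IsProbabilityMeasure P'] (hlam : 0 < lam)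
    {hT : 0 < T} {φ ψ : Measure (EuclideanSpace ℝ (Fin N))}
    (hZ : IsAssociatedBernsteinProcess hT (mehlerKernel N lam) φ ψ Z P)
    (hZ' : IsAssociatedBernsteinProcess hT (mehlerKernel N lam) φ ψ Z' P')
    {z e : Icc (0 : ℝ) T} (hz : (z : ℝ) = 0) (he : (e : ℝ) = T)
    (S : Finset (Icc (0 : ℝ) T)) (hS : ∀ τ ∈ S, z < τ ∧ τ < e)
    (l : Icc (0 : ℝ) T → StrongDual ℝ (EuclideanSpace ℝ (Fin N))) :
    ∫ ω, Complex.exp ((∑ τ ∈ insert z (insert e S), l τ (Z τ ω) : ℝ) * Complex.I) ∂P =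
      ∫ ω, Complex.exp ((∑ τ ∈ insert z (insert e S), l τ (Z' τ ω) : ℝ) * Complex.I) ∂P' := by
  have hze : z < e := by rw [← Subtype.coe_lt_coe, hz, he]; exact hT
  -- The latest interior time `r` is removed: its right neighbour is always `e`, its left neighbour
  -- the largest remaining time. Since the functionals change at each removal, `l` is generalized.
  induction S using Finset.induction_on_max generalizing l with
  | empty =>
    rw [hZ.integral_exp_sum_pair hz he hze.ne, hZ'.integral_exp_sum_pair hz he hze.ne]
  | insert r S hr ih =>
    have hzr := (hS r (Finset.mem_insert_self _ _)).1
    have hre := (hS r (Finset.mem_insert_self _ _)).2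
    obtain ⟨s, hsS, hsr, hSs⟩ : ∃ s ∈ insert z S, s < r ∧ ∀ τ ∈ insert z S, τ ≤ s := by
      obtain ⟨s, hs, h⟩ := (insert z S).exists_max_image id ⟨z, Finset.mem_insert_self _ _⟩
      refine ⟨s, hs, ?_, h⟩
      rcases Finset.mem_insert.1 hs with rfl | hs
      · exact hzr
      · exact hr s hs
    set S₀ := insert z (insert e S) with hS₀
    have hrS₀ : r ∉ S₀ := by
      simp only [hS₀, Finset.mem_insert, not_or]
      exact ⟨hzr.ne', hre.ne, fun h ↦ (hr r h).false⟩
    have heS₀ : e ∈ S₀ := by simp [hS₀]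
    have hsS₀ : s ∈ S₀ := by
      rw [hS₀, Finset.insert_comm]
      exact Finset.mem_insert_of_mem hsS
    have hobs (τ : Icc (0 : ℝ) T) (hτ : τ ∈ S₀) : τ ∈ Iic s ∪ Ici e := by
      rw [hS₀, Finset.insert_comm, Finset.mem_insert] at hτ
      rcases hτ with rfl | hτ
      · simp
      · exact Or.inl (hSs τ hτ)
    have e1 : insert z (insert e (insert r S)) = insert r S₀ := by
      rw [hS₀, Finset.insert_comm e r, Finset.insert_comm z r]
    rw [e1, hZ.integral_exp_sum_insert hlam hsr hre hrS₀ heS₀ hsS₀ hobs,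
      hZ'.integral_exp_sum_insert hlam hsr hre hrS₀ heS₀ hsS₀ hobs,
      ih fun τ hτ ↦ hS τ (Finset.mem_insert_of_mem hτ)]

lemma identDistrib_of_forall_finset {ι E : Type*} [MeasurableSpace E] [IsProbabilityMeasure P]
    {X : ι → Ω → E} {Y : ι → Ω' → E} (hX : ∀ t, Measurable (X t)) (hY : ∀ t, Measurable (Y t))
    (h : ∀ I : Finset ι, P.map (fun ω ↦ I.restrict (X · ω)) = P'.map (fun ω ↦ I.restrict (Y · ω))) :
    IdentDistrib (fun ω t ↦ X t ω) (fun ω t ↦ Y t ω) P P' := by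
  have hX' : Measurable fun ω t ↦ X t ω := measurable_pi_lambda _ hX
  have hY' : Measurable fun ω t ↦ Y t ω := measurable_pi_lambda _ hY
  refine ⟨hX'.aemeasurable, hY'.aemeasurable, ?_⟩
  have (I : Finset ι) : IsProbabilityMeasure (P.map (fun ω ↦ I.restrict (X · ω))) :=
    have hI : Measurable fun ω ↦ I.restrict (X · ω) := measurable_pi_lambda _ fun i ↦ hX i
    Measure.isProbabilityMeasure_map hI.aemeasurable
  refine (isProjectiveLimit_map hX'.aemeasurable).unique ?_
  simp only [h]
  exact isProjectiveLimit_map hY'.aemeasurable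

/-- The law of the associated Bernstein process is unique. -/
lemma IsAssociatedBernsteinProcess.identDistrib [IsProbabilityMeasure P] [IsProbabilityMeasure P']
    (hlam : 0 < lam) {hT : 0 < T} {φ ψ : Measure (EuclideanSpace ℝ (Fin N))}
    (hZ : IsAssociatedBernsteinProcess hT (mehlerKernel N lam) φ ψ Z P)
    (hZ' : IsAssociatedBernsteinProcess hT (mehlerKernel N lam) φ ψ Z' P') :
    IdentDistrib (fun ω t ↦ Z t ω) (fun ω t ↦ Z' t ω) P P' := by
  classical
  have hm := hZ.isBernsteinProcess.measurable
  have hm' := hZ'.isBernsteinProcess.measurable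
  refine identDistrib_of_forall_finset hm hm' fun I ↦ ?_
  have hI : Measurable fun ω ↦ I.restrict (Z · ω) := measurable_pi_lambda _ fun i ↦ hm i
  have hI' : Measurable fun ω ↦ I.restrict (Z' · ω) := measurable_pi_lambda _ fun i ↦ hm' i
  have := Measure.isProbabilityMeasure_map (μ := P) hI.aemeasurable
  have := Measure.isProbabilityMeasure_map (μ := P') hI'.aemeasurable
  refine Measure.ext_of_charFunDual (funext fun L ↦ ?_)
  rw [charFunDual_apply, charFunDual_apply, integral_map hI.aemeasurable (by fun_prop),
    integral_map hI'.aemeasurable (by fun_prop)]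
  let z : Icc (0 : ℝ) T := ⟨0, left_mem_Icc.2 hT.le⟩
  let e : Icc (0 : ℝ) T := ⟨T, right_mem_Icc.2 hT.le⟩
  -- The value `0` off `I` allows both endpoints to be added to the set of times without changing
  -- the sum.
  let l (τ : Icc (0 : ℝ) T) : StrongDual ℝ (EuclideanSpace ℝ (Fin N)) :=
    if h : τ ∈ I then L.comp (ContinuousLinearMap.single ℝ (fun _ : I ↦ _) ⟨τ, h⟩) else 0
  have hsub : I ⊆ insert z (insert e (I.filter fun τ ↦ z < τ ∧ τ < e)) := by
    intro τ hτ
    simp only [Finset.mem_insert, Finset.mem_filter, hτ, true_and]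
    have h1 : z ≤ τ := τ.2.1
    have h2 : τ ≤ e := τ.2.2
    rcases h1.eq_or_lt with h1 | h1
    · exact Or.inl h1.symm
    · exact Or.inr (h2.eq_or_lt.imp_right fun h2 ↦ ⟨h1, h2⟩)
  have hsum (x : Icc (0 : ℝ) T → EuclideanSpace ℝ (Fin N)) :
      ∑ τ ∈ insert z (insert e (I.filter fun τ ↦ z < τ ∧ τ < e)), l τ (x τ) =
        L (I.restrict x) := by
    rw [← Finset.sum_subset hsub fun τ _ hτ ↦ by simp [l, hτ], ← Finset.sum_coe_sort]
    conv_rhs => rw [← Finset.univ_sum_single (I.restrict x), map_sum]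
    refine Finset.sum_congr rfl fun i _ ↦ ?_
    simp [l]
  have h := integral_exp_sum_eq hlam hZ hZ' (z := z) (e := e) rfl rfl
    (I.filter fun τ ↦ z < τ ∧ τ < e) (fun τ hτ ↦ (Finset.mem_filter.1 hτ).2) l
  simpa only [hsum] using h

lemma IsOUVector.of_identDistrib (hZ : IsOUVector lam Z P) (hZ' : ∀ t, Measurable (Z' t))
    (h : IdentDistrib (fun ω t ↦ Z t ω) (fun ω t ↦ Z' t ω) P P') : IsOUVector lam Z' P' := by
  have hmean (t : Icc (0 : ℝ) T) (i : Fin N) : ∫ ω, Z' t ω i ∂P' = 0 := by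
    have h1 := (h.comp (u := fun x ↦ x t i) (by fun_prop)).integral_eq
    exact h1.symm.trans (hZ.integral_eq_zero t i)
  refine ⟨hZ', ⟨fun I ↦ ⟨?_⟩⟩, hmean, fun s t i j ↦ ?_⟩
  · have h1 := (h.comp (u := fun x (p : I) ↦ x p.1.1 p.1.2) (by fun_prop)).map_eq
    exact h1 ▸ (hZ.isGaussianProcess.hasGaussianLaw I).isGaussian_map
  · have h1 := (h.comp (u := fun x ↦ x s i * x t j) (by fun_prop)).integral_eq
    have h2 := hZ.covariance s t i j
    unfold ProbabilityTheory.covariance at h2 ⊢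
    simp only [hmean, hZ.integral_eq_zero, sub_zero] at h2 ⊢
    exact h1.symm.trans h2

end Uniqueness

/-! ### Existence on a complete space and explicit formulas -/

section Existence

variable {N : ℕ} {T lam : ℝ} {Ω : Type*} {mΩ : MeasurableSpace Ω} {P : Measure Ω}

/-- Independent stationary Ornstein-Uhlenbeck processes form an Ornstein-Uhlenbeck vector. -/
lemma isOUVector_toLp {X : Fin N → ℝ≥0 → Ω → ℝ} (hX : ∀ i t, Measurable (X i t))
    (hG : IsGaussianProcess (fun p : Fin N × ℝ≥0 ↦ X p.1 p.2) P)
    (hmean : ∀ i t, ∫ ω, X i t ω ∂P = 0)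
    (hcov : ∀ i j s t, cov[X i s, X j t; P] =
      if i = j then Real.exp (-lam * |(s : ℝ) - t|) / (2 * lam) else 0) :
    IsOUVector lam (fun (t : Icc (0 : ℝ) T) ω ↦
      (WithLp.toLp 2 fun i ↦ X i ⟨t, t.2.1⟩ ω : EuclideanSpace ℝ (Fin N))) P where
  measurable t := by fun_prop
  isGaussianProcess := hG.comp_right fun p : Icc (0 : ℝ) T × Fin N ↦ (p.2, ⟨p.1, p.1.2.1⟩)
  integral_eq_zero t i := hmean i _
  covariance s t i j := hcov i j _ _

lemma map_completion {E : Type*} [MeasurableSpace E] {f : Ω → E} (hf : Measurable f) :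
    P.completion.map (fun ω : NullMeasurableSpace Ω P ↦ f ω) = P.map f := by
  have hf' : Measurable fun ω : NullMeasurableSpace Ω P ↦ f ω :=
    fun S hS ↦ (hf hS).nullMeasurableSet
  ext S hS
  rw [Measure.map_apply hf' hS, Measure.map_apply hf hS]
  exact Measure.completion_apply P _

/-- Completion does not change the law, and being an Ornstein–Uhlenbeck vector depends only on the
law and measurability. Thus no conditional expectation has to be transported to the completed space.
-/
lemma exists_isAssociatedBernsteinProcess_isComplete [IsProbabilityMeasure P]
    (hlam : 0 < lam) (hT : 0 < T) {Z : Icc (0 : ℝ) T → Ω → EuclideanSpace ℝ (Fin N)}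
    (hZ : IsOUVector lam Z P) :
    IsProbabilityMeasure P.completion ∧ P.completion.IsComplete ∧
      IsAssociatedBernsteinProcess hT (mehlerKernel N lam) (groundStateMeasure N lam T)
        (groundStateMeasure N lam T) (fun t (ω : NullMeasurableSpace Ω P) ↦ Z t ω)
        P.completion := by
  refine ⟨⟨?_⟩, inferInstance, IsOUVector.isAssociatedBernsteinProcess hlam hT
    (hZ.of_identDistrib (fun t S hS ↦ (hZ.measurable t hS).nullMeasurableSet) ?_)⟩
  · exact (Measure.completion_apply P univ).trans measure_univ
  · have hm : Measurable fun ω t ↦ Z t ω := measurable_pi_lambda _ hZ.measurable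
    have hm' : Measurable fun (ω : NullMeasurableSpace Ω P) t ↦ Z t ω :=
      fun S hS ↦ (hm hS).nullMeasurableSet
    exact ⟨hm.aemeasurable, hm'.aemeasurable, (map_completion hm).symm⟩

lemma IsOUVector.isGaussianProcess_vector {Z : Icc (0 : ℝ) T → Ω → EuclideanSpace ℝ (Fin N)}
    (hZ : IsOUVector lam Z P) : IsGaussianProcess Z P := by
  classical
  let L (t : Icc (0 : ℝ) T) :
      ((Finset.univ.image fun i : Fin N ↦ (t, i) : Finset _) → ℝ) →L[ℝ] (Fin N → ℝ) :=
    { toFun x i := x ⟨(t, i), by simp⟩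
      map_add' x y := by ext; simp
      map_smul' c x := by ext; simp }
  exact hZ.isGaussianProcess.of_isGaussianProcess fun t ↦ ⟨_,
    (PiLp.continuousLinearEquiv 2 ℝ (fun _ : Fin N ↦ ℝ)).symm.toContinuousLinearMap.comp (L t),
    fun ω ↦ rfl⟩

lemma IsOUVector.measureReal_preimage (hlam : 0 < lam)
    {Z : Icc (0 : ℝ) T → Ω → EuclideanSpace ℝ (Fin N)} (hZ : IsOUVector lam Z P)
    (t : Icc (0 : ℝ) T) {E : Set (EuclideanSpace ℝ (Fin N))} (hE : MeasurableSet E) :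
    P.real (Z t ⁻¹' E) = (2 * Real.pi * (1 / (2 * lam))) ^ (-(N : ℝ) / 2) *
      ∫ x in E, Real.exp (-‖x‖ ^ 2 / (2 * (1 / (2 * lam)))) := by
  have hv : 0 < 1 / (2 * lam) := by positivity
  rw [← map_measureReal_apply (hZ.measurable t) hE, (hZ.hasLaw hlam t).map_eq,
    isoGaussian_real_apply N (Real.toNNReal_pos.2 hv).ne' hE, Real.coe_toNNReal _ hv.le,
    ← integral_const_mul]
  rfl

lemma IsOUVector.integral_mul {Z : Icc (0 : ℝ) T → Ω → EuclideanSpace ℝ (Fin N)}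
    (hZ : IsOUVector lam Z P) (s t : Icc (0 : ℝ) T) (i j : Fin N) :
    ∫ ω, Z s ω i * Z t ω j ∂P =
      if i = j then Real.exp (-lam * |(t : ℝ) - (s : ℝ)|) / (2 * lam) else 0 := by
  have h := hZ.covariance s t i j
  unfold ProbabilityTheory.covariance at h
  simp only [hZ.integral_eq_zero, sub_zero] at h
  rw [h, ouCov_comm]
  rfl

end Existence

end Bernstein

end

theorem proposition1 (N : ℕ) (hN : 0 < N) (T : ℝ) (hT : 0 < T) (lam : ℝ) (hlam : 0 < lam) :
    -- the associated process exists, on a complete probability space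
    (∃ (Ω : Type) (_ : MeasurableSpace Ω) (P : Measure Ω)
        (Z : Icc (0 : ℝ) T → Ω → EuclideanSpace ℝ (Fin N)),
      IsProbabilityMeasure P ∧ P.IsComplete ∧
      Bernstein.IsAssociatedBernsteinProcess hT (Bernstein.mehlerKernel N lam)
        (Bernstein.groundStateMeasure N lam T) (Bernstein.groundStateMeasure N lam T) Z P) ∧
    -- and every realization of it has the following properties
    ∀ (Ω : Type*) [MeasurableSpace Ω] (P : Measure Ω) [IsProbabilityMeasure P]
      (Z : Icc (0 : ℝ) T → Ω → EuclideanSpace ℝ (Fin N)),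
      Bernstein.IsAssociatedBernsteinProcess hT (Bernstein.mehlerKernel N lam)
        (Bernstein.groundStateMeasure N lam T) (Bernstein.groundStateMeasure N lam T) Z P →
      IsGaussianProcess Z P ∧
      Bernstein.IsMarkovProcess Z P ∧
      (∀ (t : Icc (0 : ℝ) T) (E : Set (EuclideanSpace ℝ (Fin N))), MeasurableSet E →
        P.real (Z t ⁻¹' E) =
          (2 * Real.pi * (1 / (2 * lam))) ^ (-(N : ℝ) / 2) *
            ∫ x in E, Real.exp (-‖x‖ ^ 2 / (2 * (1 / (2 * lam))))) ∧
      (∀ (s t : Icc (0 : ℝ) T) (i j : Fin N),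
        Integrable (fun ω ↦ Z s ω i * Z t ω j) P ∧
        ∫ ω, Z s ω i * Z t ω j ∂P =
          if i = j then Real.exp (-lam * |(t : ℝ) - (s : ℝ)|) / (2 * lam) else 0) ∧
      (∃ (Ω' : Type) (_ : MeasurableSpace Ω') (P' : Measure Ω') (X : Fin N → ℝ≥0 → Ω' → ℝ),
        IsProbabilityMeasure P' ∧
        iIndepFun (fun i ω (t : ℝ≥0) ↦ X i t ω) P' ∧
        (∀ i, Bernstein.IsStationaryOrnsteinUhlenbeck lam (X i) P') ∧
        IdentDistrib (fun ω (t : Icc (0 : ℝ) T) ↦ Z t ω)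
          (fun ω (t : Icc (0 : ℝ) T) ↦
            (WithLp.toLp 2 (fun i ↦ X i ⟨t, t.2.1⟩ ω) : EuclideanSpace ℝ (Fin N))) P P') := by
  obtain ⟨Ω₀, _, P₀, X, _, hXm, hXG, hXmean, hXcov, hXind, hXou⟩ :=
    Bernstein.exists_stationaryOrnsteinUhlenbeck N hlam
  have hX := Bernstein.isOUVector_toLp (T := T) hXm hXG hXmean hXcov
  refine ⟨?_, fun Ω _ P _ Z hZ ↦ ?_⟩
  · exact ⟨_, _, _, _, Bernstein.exists_isAssociatedBernsteinProcess_isComplete hlam hT hX⟩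
  -- By uniqueness `Z` has the law of the constructed vector, hence is itself an Ornstein–Uhlenbeck
  -- vector.
  · have hid := (hX.isAssociatedBernsteinProcess hlam hT).identDistrib hlam hZ
    have hOU := hX.of_identDistrib hZ.isBernsteinProcess.measurable hid
    exact ⟨hOU.isGaussianProcess_vector, hOU.isMarkovProcess hlam,
      fun t E hE ↦ hOU.measureReal_preimage hlam t hE,
      fun s t i j ↦ ⟨(hOU.memLp s i).integrable_mul (hOU.memLp t j), hOU.integral_mul s t i j⟩,
      Ω₀, _, P₀, X, inferInstance, hXind, hXou, hid.symm⟩
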